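/- **Convergence of two-grid Meta-MgNet for Poisson's equation.** Let $M\ge 1$, $N=2M$, $h=1/N$, and discretize $-\Delta u=f$ on $\Omega=(0,1)^2$ with $u=0$ on $\partial\Omega$ on the uniform $N\times N$ mesh, with one unknown per interior node $p\in\{1,\dots,N-1\}^2$. The scheme is one of the following, and $\mathbf A=\mathbf A_N$ is its matrix: - a finite difference scheme $(\mathbf A v)(p)=h^{-2}\sum_{a,b}K_{a,b}\,v(p+(a,b))$ ($v=0$ on the boundary), where the fixed stencil $K$ is supported in $\{-1,0,1\}^2$ (this includes 5- and 7-point stencils), is symmetric ($K_{-a,-b}=K_{a,b}$), is consistent with $-\Delta$ ($\sum K_{a,b}=0$, $\sum a^2K_{a,b}=\sum b^2K_{a,b}=-2$, $\sum ab\,K_{a,b}=0$), and is elliptic ($\sum K_{a,b}\cos(a\theta+b\varphi)>0$ for $(\theta,\varphi)\in(-\pi,\pi]^2\setminus\{0\}$); - P1 elements on the triangulation obtained by cutting each mesh square along its diagonal parallel to $(1,1)$, or Q1 (bilinear) elements, with $\mathbf A_{pq}=\int_\Omega\nabla\varphi_q\cdot\nabla\varphi_p$ for the nodal basis functions $\varphi_p$.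 Let $\mathbf P$ be the prolongation from the $M\times M$ mesh, $\mathbf P_{pq}=\pi(p-2q)$, where $\pi$ is either the 7-point stencil (weight $1$ at $0$ and $\tfrac12$ at $\pm(1,0),\pm(0,1),\pm(1,1)$) or the 9-point stencil (weights $\pi(a,b)=2^{-|a|-|b|}$ for $|a|,|b|\le1$). Put $\mathbf A_c=\mathbf P^\top\mathbf A\mathbf P$, $\mathbf C=\mathbf P\mathbf A_c^{-1}\mathbf P^\top\mathbf A$, let $\rho_{\mathbf A}$ be the spectral radius of $\mathbf A$, and write $\|v\|_{\mathbf S}^2=v^\top \mathbf S v$. Let the Meta-NN be any map $\mathbf r\mapsto \mathbf G=\mathbf G(\mathbf r)\in\mathbb R^{(N-1)^2\times L}$ such that for each $\mathbf r\ne0$ the columns of $\mathbf G(\mathbf r)$ are linearly independent and $\mathbf r\in\mathrm{range}(\mathbf G(\mathbf r))$; put $\mathbf B_{\mathbf r}=\mathbf G(\mathbf G^\top \mathbf A\mathbf G)^{-1}\mathbf G^\top$ (if $\mathbf G^\top\mathbf A\mathbf G$ is singular, which can happen only for $\mathbf r=0$, put $\mathbf B_{0}=0$). For arbitrary $\mathbf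 u_0$ and $\mathbf A\mathbf u=\mathbf f$, the two-grid Meta-MgNet iteration is $$\mathbf u_{t+\frac12}=\mathbf u_t+\mathbf P\mathbf A_c^{-1}\mathbf P^\top(\mathbf f-\mathbf A\mathbf u_t),\qquad \mathbf r_{t+1}=\mathbf f-\mathbf A\mathbf u_{t+\frac12},\qquad \mathbf u_{t+1}=\mathbf u_{t+\frac12}+\mathbf B_{\mathbf r_{t+1}}\mathbf r_{t+1}.$$ Then the following hold. 1. (Smoother.) There is a constant $c_s>0$, independent of the scheme, the mesh, the Meta-NN and $\mathbf r$, such that for every $\mathbf r$ the matrix $\mathbf B_{\mathbf r}$ is symmetric positive semidefinite, $\mathbf B_{\mathbf r}\mathbf A\mathbf B_{\mathbf r}=\mathbf B_{\mathbf r}$, and $\|\mathbf r\|^2\le c_s\,\rho_{\mathbf A}\,\mathbf r^\top\mathbf B_{\mathbf r}\mathbf r$. 2. (Coarse grid correction.) $\mathbf A$ and $\mathbf A_c$ are symmetric positive definite, $\|(\mathbf I-\mathbf C)v\|_{\mathbf A}^2\le\|v\|_{\mathbf A}^2$ for all $v$, and for each scheme and prolongation there is a constant $c_a>0$, independent of $M$,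 such that $\|(\mathbf I-\mathbf C)v\|_{\mathbf A}^2\le c_a\,\rho_{\mathbf A}^{-1}\|v\|_{\mathbf A^2}^2$ for all $v$. 3. (Convergence.) Whenever $c_a,c_s>0$ are constants for which, on the given mesh, the last inequality of 2 holds for all $v$ and the properties in 1 hold for all $\mathbf r$, the number $\delta=1-\frac1{c_ac_s}$ satisfies $0\le\delta<1$ and $$\|\mathbf u-\mathbf u_t\|_{\mathbf A}\le\delta^{t/2}\,\|\mathbf u-\mathbf u_0\|_{\mathbf A}\qquad\text{for all } t=0,1,2,\dots$$ -/

import Mathlib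

open Matrix

noncomputable section

namespace MetaMgNet

/-! ### The model problem `-Δu = f` on the unit square, `u = 0` on the boundary -/

/-- Interior nodes of the uniform `N × N` mesh of the unit square (mesh size `h = 1 / N`). -/
abbrev Node (N : ℕ) : Type := Fin (N - 1) × Fin (N - 1)

/-- First integer coordinate of a node; it lies in `{1, …, N - 1}`. -/
def xc {N : ℕ} (p : Node N) : ℤ := (p.1 : ℤ) + 1

/-- Second integer coordinate of a node; it lies in `{1, …, N - 1}`. -/
def yc {N : ℕ} (p : Node N) : ℤ := (p.2 : ℤ) + 1

/-- `K` is the (unscaled) stencil of a symmetric finite difference scheme for `-Δ` that uses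
at most the nine points with offsets in `{-1, 0, 1}²` (so five-point and seven-point stencils are
included). The moment conditions say that the scheme is consistent with `-Δ`, i.e. exact on
quadratic polynomials; the last condition is ellipticity of the difference operator (positivity of
its Fourier symbol). -/
structure IsPoissonStencil (K : ℤ → ℤ → ℝ) : Prop where
  support : ∀ a b : ℤ, 1 < |a| ∨ 1 < |b| → K a b = 0
  symm : ∀ a b : ℤ, K (-a) (-b) = K a b
  moment_zero : ∑ a ∈ Finset.Icc (-1 : ℤ) 1, ∑ b ∈ Finset.Icc (-1 : ℤ) 1, K a b = 0
  moment_xx : ∑ a ∈ Finset.Icc (-1 : ℤ) 1, ∑ b ∈ Finset.Icc (-1 : ℤ) 1,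
    K a b * (a : ℝ) ^ 2 = -2
  moment_yy : ∑ a ∈ Finset.Icc (-1 : ℤ) 1, ∑ b ∈ Finset.Icc (-1 : ℤ) 1,
    K a b * (b : ℝ) ^ 2 = -2
  moment_xy : ∑ a ∈ Finset.Icc (-1 : ℤ) 1, ∑ b ∈ Finset.Icc (-1 : ℤ) 1,
    K a b * ((a : ℝ) * (b : ℝ)) = 0
  elliptic : ∀ θ ∈ Set.Ioc (-Real.pi) Real.pi, ∀ φ ∈ Set.Ioc (-Real.pi) Real.pi,
    (θ ≠ 0 ∨ φ ≠ 0) →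
      0 < ∑ a ∈ Finset.Icc (-1 : ℤ) 1, ∑ b ∈ Finset.Icc (-1 : ℤ) 1,
        K a b * Real.cos ((a : ℝ) * θ + (b : ℝ) * φ)

/-- The finite difference matrix: `(A v)(p) = h⁻² ∑ K(a, b) v(p + (a, b))`, where `v` is extended
by zero to the boundary nodes. -/
def fdmMatrix (N : ℕ) (K : ℤ → ℤ → ℝ) : Matrix (Node N) (Node N) ℝ :=
  Matrix.of fun p q => (N : ℝ) ^ 2 * K (xc q - xc p) (yc q - yc p)

/-- The reference P1 hat function at the origin, for the mesh of unit squares cut into triangles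
by the diagonals parallel to `(1, 1)`. -/
def hatP1 (s t : ℝ) : ℝ := max 0 (1 - max (max |s| |t|) |s - t|)

/-- The reference Q1 (bilinear) hat function at the origin. -/
def hatQ1 (s t : ℝ) : ℝ := max 0 (1 - |s|) * max 0 (1 - |t|)

/-- The nodal basis function of the node `p`, generated by translation and scaling. -/
def basisFun (N : ℕ) (hat : ℝ → ℝ → ℝ) (p : Node N) (s t : ℝ) : ℝ :=
  hat ((N : ℝ) * s - (xc p : ℝ)) ((N : ℝ) * t - (yc p : ℝ))

/-- The stiffness matrix `∫_Ω ∇φ_q · ∇φ_p` over the unit square `Ω`. The basis functions are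
piecewise polynomial, so the pointwise partial derivatives are the weak ones almost everywhere. -/
def stiffnessMatrix (N : ℕ) (hat : ℝ → ℝ → ℝ) : Matrix (Node N) (Node N) ℝ :=
  Matrix.of fun p q => ∫ t in (0 : ℝ)..1, ∫ s in (0 : ℝ)..1,
    (deriv (fun x => basisFun N hat q x t) s * deriv (fun x => basisFun N hat p x t) s +
      deriv (fun y => basisFun N hat q s y) t * deriv (fun y => basisFun N hat p s y) t)

/-- The discretizations: finite differences, P1 elements, Q1 elements. -/
inductive Scheme : Type
  | fdm (K : ℤ → ℤ → ℝ) (hK : IsPoissonStencil K) : Scheme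
  | femP1 : Scheme
  | femQ1 : Scheme

/-- The system matrix `A` of a discretization on the `N × N` mesh. -/
def Scheme.matrix (d : Scheme) (N : ℕ) : Matrix (Node N) (Node N) ℝ :=
  match d with
  | .fdm K _ => fdmMatrix N K
  | .femP1 => stiffnessMatrix N hatP1
  | .femQ1 => stiffnessMatrix N hatQ1

/-! ### Prolongations -/

/-- The two interpolation stencils. -/
inductive Prolongation : Type
  | sevenPoint : Prolongation
  | ninePoint : Prolongation

/-- Seven-point stencil: weight `1` at the origin and `1/2` at `±(1,0)`, `±(0,1)`, `±(1,1)`.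
Nine-point stencil: weights `1`, `1/2` (edges), `1/4` (corners). -/
def Prolongation.stencil (π : Prolongation) (a b : ℤ) : ℝ :=
  match π with
  | .sevenPoint =>
      if a = 0 ∧ b = 0 then 1
      else if |a| ≤ 1 ∧ |b| ≤ 1 ∧ |a - b| ≤ 1 then 1 / 2 else 0
  | .ninePoint =>
      if a = 0 ∧ b = 0 then 1
      else if |a| + |b| = 1 then 1 / 2
      else if |a| = 1 ∧ |b| = 1 then 1 / 4 else 0

/-- The prolongation matrix `P` from the `M × M` mesh to the `2M × 2M` mesh; the coarse node `q`
is the fine node with coordinates `2 q`. -/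
def Prolongation.matrix (π : Prolongation) (M : ℕ) : Matrix (Node (2 * M)) (Node M) ℝ :=
  Matrix.of fun p q => π.stencil (xc p - 2 * xc q) (yc p - 2 * yc q)

/-! ### Norms, coarse grid correction, smoother, iteration -/

section Abstract

variable {ι κ μ : Type} [Fintype ι] [DecidableEq ι] [Fintype κ] [DecidableEq κ]
  [Fintype μ] [DecidableEq μ]

/-- The norm `‖v‖_A = √(vᵀ A v)` of a symmetric positive definite matrix `A`. -/
def energyNorm (A : Matrix ι ι ℝ) (v : ι → ℝ) : ℝ := Real.sqrt (v ⬝ᵥ (A *ᵥ v))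

/-- The spectral radius `ρ_A` of a (symmetric) real matrix. -/
def rho (A : Matrix ι ι ℝ) : ℝ := (spectralRadius ℝ A).toReal

/-- The Galerkin coarse grid matrix `A_c = Pᵀ A P`. -/
def coarseMatrix (A : Matrix ι ι ℝ) (P : Matrix ι κ ℝ) : Matrix κ κ ℝ := Pᵀ * A * P

/-- The operator `C = P A_c⁻¹ Pᵀ A`. -/
def coarseCorrection (A : Matrix ι ι ℝ) (P : Matrix ι κ ℝ) : Matrix ι ι ℝ :=
  P * (coarseMatrix A P)⁻¹ * Pᵀ * A

/-- Stability: `‖(I - C) v‖_A² ≤ ‖v‖_A²`. -/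
def Stability (A : Matrix ι ι ℝ) (P : Matrix ι κ ℝ) : Prop :=
  ∀ v : ι → ℝ, energyNorm A ((1 - coarseCorrection A P) *ᵥ v) ^ 2 ≤ energyNorm A v ^ 2

/-- Approximation property: `‖(I - C) v‖_A² ≤ c_a ρ_A⁻¹ ‖v‖_{A²}²`. -/
def Approximation (A : Matrix ι ι ℝ) (P : Matrix ι κ ℝ) (ca : ℝ) : Prop :=
  ∀ v : ι → ℝ, energyNorm A ((1 - coarseCorrection A P) *ᵥ v) ^ 2 ≤
    ca * (rho A)⁻¹ * energyNorm (A ^ 2) v ^ 2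

/-- The subspace correction smoother `B = G (Gᵀ A G)⁻¹ Gᵀ`. -/
def smoother (A : Matrix ι ι ℝ) (G : Matrix ι μ ℝ) : Matrix ι ι ℝ :=
  G * (Gᵀ * A * G)⁻¹ * Gᵀ

/-- A Meta-NN `r ↦ G(r)` is admissible if, for every nonzero residual `r`, the columns of `G(r)`
are linearly independent and `r` lies in the range of `G(r)`. -/
def Admissible (𝒢 : (ι → ℝ) → Matrix ι μ ℝ) : Prop :=
  ∀ r : ι → ℝ, r ≠ 0 →
    LinearIndependent ℝ (fun l : μ => fun i : ι => 𝒢 r i l) ∧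
      r ∈ LinearMap.range (Matrix.mulVecLin (𝒢 r))

/-- Smoother property with constant `c_s`: for every residual `r`, the matrix `B_r` is symmetric
positive semidefinite, `B_r A B_r = B_r` and `‖r‖² ≤ c_s ρ_A rᵀ B_r r`. -/
def SmootherProperty (A : Matrix ι ι ℝ) (𝒢 : (ι → ℝ) → Matrix ι μ ℝ) (cs : ℝ) : Prop :=
  ∀ r : ι → ℝ,
    (smoother A (𝒢 r)).PosSemidef ∧
    smoother A (𝒢 r) * A * smoother A (𝒢 r) = smoother A (𝒢 r) ∧
    r ⬝ᵥ r ≤ cs * rho A * (r ⬝ᵥ (smoother A (𝒢 r) *ᵥ r))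

/-- One two-grid step: coarse grid correction, then one meta-smoothing step whose smoother is
determined by the current residual. -/
def step (A : Matrix ι ι ℝ) (P : Matrix ι κ ℝ) (𝒢 : (ι → ℝ) → Matrix ι μ ℝ)
    (f u : ι → ℝ) : ι → ℝ :=
  let uHalf := u + P *ᵥ ((coarseMatrix A P)⁻¹ *ᵥ (Pᵀ *ᵥ (f - A *ᵥ u)))
  let r := f - A *ᵥ uHalf
  uHalf + smoother A (𝒢 r) *ᵥ r

/-- The Meta-MgNet sequence `u_t` with initial guess `u₀`. -/
def iterates (A : Matrix ι ι ℝ) (P : Matrix ι κ ℝ) (𝒢 : (ι → ℝ) → Matrix ι μ ℝ)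
    (f u₀ : ι → ℝ) : ℕ → ι → ℝ
  | 0 => u₀
  | t + 1 => step A P 𝒢 f (iterates A P 𝒢 f u₀ t)

end Abstract

end MetaMgNet

end

noncomputable section

namespace MetaMgNet

/-! ### Two-grid theory for an arbitrary positive definite matrix. -/

section General

set_option linter.unusedSectionVars false

variable {ι κ μ : Type} [Fintype ι] [DecidableEq ι] [Fintype κ] [DecidableEq κ]
  [Fintype μ] [DecidableEq μ]

/-! All schemes reduce to one family. With `L = tridiag(-1, 2, -1)`, consistency and symmetry force
every stencil into the form `L ⊗ 1 + 1 ⊗ L + γ L ⊗ L` up to a positive factor, and ellipticity at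
the frequency `(π, π)` gives `γ > -1/2`. P1 elements give `γ = 0`, Q1 elements `γ = -1/3`
(`Scheme.exists_matrix_eq`). For such `γ` the operator is bounded, and its square dominates that of
the five-point operator, uniformly in the mesh (`ninePointMatrix_bounds`).

Approximation: `I - C` gives the energy-best error over the coarse space, so it may be compared with
interpolation of the nodal values at coarse nodes. That error is a combination of second differences
of `v`. On the square the discrete Laplacian controls all of these, because the two directions
commute; this replaces elliptic regularity (`lap₂_sq_eq`, `interpolation_error_le`).

Smoother: since `r` lies in the range of `G`, `B A r = r`. Positivity of `B` tested on `ρ r - A r`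
then yields `‖r‖² ≤ ρ rᵀ B r`, so `c_s = 1` works.

Convergence: let `e` be the error after coarse correction. Then `(I - C) e = e`, and `B A B = B`
gives `‖e - B A e‖_A² = ‖e‖_A² - (A e)ᵀ B (A e)`. The approximation and smoother inequalities bound
the subtracted term below by `‖e‖_A² / (c_a c_s)`. Only the current residual enters, so the
dependence of `B` on it is harmless. Finally `c_a c_s ≥ 1`, because the coarse space is strictly
smaller and so some nonzero `e` has `Pᵀ A e = 0`. -/

theorem dotProduct_mulVec_comm {A : Matrix ι ι ℝ} (hA : Aᵀ = A) (v w : ι → ℝ) :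
    v ⬝ᵥ (A *ᵥ w) = w ⬝ᵥ (A *ᵥ v) := by
  rw [dotProduct_mulVec, ← mulVec_transpose, hA, dotProduct_comm]

theorem mulVec_dotProduct_mulVec (A : Matrix κ ι ℝ) (v : ι → ℝ) (w : κ → ℝ) :
    (A *ᵥ v) ⬝ᵥ w = v ⬝ᵥ (Aᵀ *ᵥ w) := by
  rw [mulVec_transpose, dotProduct_comm, dotProduct_mulVec, dotProduct_comm]

theorem PosSemidef_transpose_eq {A : Matrix ι ι ℝ} (hA : A.PosSemidef) : Aᵀ = A := by
  have h := hA.isHermitian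
  rwa [IsHermitian, conjTranspose_eq_transpose_of_trivial] at h

theorem PosSemidef_quad_nonneg {A : Matrix ι ι ℝ} (hA : A.PosSemidef) (v : ι → ℝ) :
    0 ≤ v ⬝ᵥ (A *ᵥ v) := by
  simpa using hA.dotProduct_mulVec_nonneg v

theorem PosDef_quad_pos {A : Matrix ι ι ℝ} (hA : A.PosDef) {v : ι → ℝ} (hv : v ≠ 0) :
    0 < v ⬝ᵥ (A *ᵥ v) := by
  simpa using hA.dotProduct_mulVec_pos hv

theorem energyNorm_sq {A : Matrix ι ι ℝ} (hA : A.PosSemidef) (v : ι → ℝ) :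
    energyNorm A v ^ 2 = v ⬝ᵥ (A *ᵥ v) :=
  Real.sq_sqrt (PosSemidef_quad_nonneg hA v)

theorem dotProduct_self_nonneg' (v : ι → ℝ) : 0 ≤ v ⬝ᵥ v :=
  Finset.sum_nonneg fun i _ => mul_self_nonneg (v i)

theorem quad_sq {A : Matrix ι ι ℝ} (hA : Aᵀ = A) (v : ι → ℝ) :
    v ⬝ᵥ (A ^ 2 *ᵥ v) = (A *ᵥ v) ⬝ᵥ (A *ᵥ v) := by
  rw [mulVec_dotProduct_mulVec, hA, pow_two, mulVec_mulVec]

theorem energyNorm_sq_sq {A : Matrix ι ι ℝ} (hA : Aᵀ = A) (v : ι → ℝ) :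
    energyNorm (A ^ 2) v ^ 2 = (A *ᵥ v) ⬝ᵥ (A *ᵥ v) := by
  rw [energyNorm, quad_sq hA, Real.sq_sqrt (dotProduct_self_nonneg' _)]

/-! ### The spectral radius -/

/-- Finiteness is needed because `toReal` would send an infinite spectral radius to `0` in `rho`. -/
theorem spectralRadius_ne_top {A : Matrix ι ι ℝ} : spectralRadius ℝ A ≠ ⊤ := by
  have hfin : (spectrum ℝ A).Finite := finite_real_spectrum
  obtain ⟨b, hb⟩ := (hfin.image (fun k : ℝ => ‖k‖₊)).bddAbove
  refine ne_top_of_le_ne_top (b := (b : ENNReal)) ENNReal.coe_ne_top ?_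
  exact iSup₂_le fun k hk => ENNReal.coe_le_coe.2 (hb ⟨k, hk, rfl⟩)

theorem rho_nonneg (A : Matrix ι ι ℝ) : 0 ≤ rho A := ENNReal.toReal_nonneg

theorem abs_le_rho {A : Matrix ι ι ℝ} {k : ℝ} (hk : k ∈ spectrum ℝ A) : |k| ≤ rho A := by
  have h : (‖k‖₊ : ENNReal) ≤ spectralRadius ℝ A :=
    le_iSup₂ (f := fun (k : ℝ) (_ : k ∈ spectrum ℝ A) => (‖k‖₊ : ENNReal)) k hk
  simpa [rho] using ENNReal.toReal_mono spectralRadius_ne_top h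

theorem rho_le {A : Matrix ι ι ℝ} {R : ℝ} (hR : 0 ≤ R) (h : ∀ k ∈ spectrum ℝ A, |k| ≤ R) :
    rho A ≤ R := by
  refine ENNReal.toReal_le_of_le_ofReal hR (iSup₂_le fun k hk => ?_)
  have := ENNReal.ofReal_le_ofReal (h k hk)
  rwa [← Real.norm_eq_abs, ofReal_norm] at this

theorem spectrum_nonneg_of_posSemidef {A : Matrix ι ι ℝ} (hA : A.PosSemidef) {k : ℝ}
    (hk : k ∈ spectrum ℝ A) : 0 ≤ k := by
  rw [hA.1.spectrum_real_eq_range_eigenvalues] at hk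
  obtain ⟨i, rfl⟩ := hk
  exact hA.eigenvalues_nonneg i

/-- The eigenvalues of the difference are `ρ - k` with `k` in the spectrum of `A`, and `k ≤ |k| ≤
ρ`. -/
theorem rho_smul_one_sub_posSemidef {A : Matrix ι ι ℝ} (hA : A.IsHermitian) :
    (rho A • (1 : Matrix ι ι ℝ) - A).PosSemidef := by
  have hH : (rho A • (1 : Matrix ι ι ℝ) - A).IsHermitian := by
    refine IsHermitian.sub ?_ hA
    simp [IsHermitian]
  rw [hH.posSemidef_iff_eigenvalues_nonneg]
  intro i
  have h := hH.eigenvalues_mem_spectrum_real i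
  generalize hH.eigenvalues i = l at h ⊢
  rw [← Algebra.algebraMap_eq_smul_one, ← spectrum.singleton_sub_eq] at h
  obtain ⟨a, ha, k, hk, h⟩ := Set.mem_sub.1 h
  have := abs_le_rho hk
  rw [Set.mem_singleton_iff.1 ha] at h
  have := le_abs_self k
  simp only [Pi.zero_apply]
  rw [← h]
  linarith

theorem quad_le_rho {A : Matrix ι ι ℝ} (hA : A.IsHermitian) (v : ι → ℝ) :
    v ⬝ᵥ (A *ᵥ v) ≤ rho A * (v ⬝ᵥ v) := by
  have h := PosSemidef_quad_nonneg (rho_smul_one_sub_posSemidef hA) v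
  rw [sub_mulVec, dotProduct_sub, smul_mulVec, one_mulVec, dotProduct_smul, smul_eq_mul] at h
  linarith

theorem rho_le_of_posSemidef {A : Matrix ι ι ℝ} {R : ℝ} (hR : 0 ≤ R) (hA : A.PosSemidef)
    (h : (R • (1 : Matrix ι ι ℝ) - A).PosSemidef) : rho A ≤ R := by
  refine rho_le hR fun k hk => ?_
  rw [abs_of_nonneg (spectrum_nonneg_of_posSemidef hA hk)]
  have h' : R - k ∈ spectrum ℝ (R • (1 : Matrix ι ι ℝ) - A) := by
    rw [← Algebra.algebraMap_eq_smul_one, ← spectrum.singleton_sub_eq]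
    exact Set.mem_sub.2 ⟨R, rfl, k, hk, rfl⟩
  linarith [spectrum_nonneg_of_posSemidef h h']

theorem rho_pos [Nonempty ι] {A : Matrix ι ι ℝ} (hA : A.PosDef) : 0 < rho A := by
  obtain ⟨i⟩ := ‹Nonempty ι›
  exact (hA.eigenvalues_pos i).trans_le ((le_abs_self _).trans
    (abs_le_rho (hA.1.eigenvalues_mem_spectrum_real i)))

/-! ### The coarse grid correction -/

theorem coarseMatrix_posDef {A : Matrix ι ι ℝ} (hA : A.PosDef) {P : Matrix ι κ ℝ}
    (hP : Function.Injective P.mulVec) : (coarseMatrix A P).PosDef := by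
  simpa [coarseMatrix] using hA.conjTranspose_mul_mul_same hP

theorem mul_coarseCorrection_transpose {A : Matrix ι ι ℝ} (hA : Aᵀ = A) (P : Matrix ι κ ℝ) :
    (A * coarseCorrection A P)ᵀ = A * coarseCorrection A P := by
  simp only [coarseCorrection, coarseMatrix, transpose_mul, transpose_nonsing_inv, hA,
    transpose_transpose, Matrix.mul_assoc]

theorem coarseCorrection_mul {A : Matrix ι ι ℝ} {P : Matrix ι κ ℝ}
    (hAc : IsUnit (coarseMatrix A P)) : coarseCorrection A P * P = P := by
  have h : coarseCorrection A P * P = P * ((coarseMatrix A P)⁻¹ * coarseMatrix A P) := by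
    simp only [coarseCorrection, coarseMatrix, Matrix.mul_assoc]
  rw [h, nonsing_inv_mul _ ((isUnit_iff_isUnit_det _).1 hAc), Matrix.mul_one]

/-- The form equals `yᵀ A_c⁻¹ y` with `y = Pᵀ A z`. -/
theorem quad_mul_coarseCorrection_nonneg {A : Matrix ι ι ℝ} (hA : A.PosSemidef)
    (P : Matrix ι κ ℝ) (z : ι → ℝ) : 0 ≤ z ⬝ᵥ ((A * coarseCorrection A P) *ᵥ z) := by
  have hT := PosSemidef_transpose_eq hA
  have hc : (coarseMatrix A P).PosSemidef := by
    simpa [coarseMatrix] using hA.conjTranspose_mul_mul_same P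
  have h := PosSemidef_quad_nonneg hc.inv (Pᵀ *ᵥ (A *ᵥ z))
  rw [mulVec_dotProduct_mulVec, mulVec_dotProduct_mulVec, hT] at h
  simpa [coarseCorrection, mulVec_mulVec, Matrix.mul_assoc] using h

/-- The coarse grid correction minimizes the energy norm of the error over the coarse space. -/
theorem quad_one_sub_coarseCorrection_le {A : Matrix ι ι ℝ} (hA : A.PosSemidef)
    {P : Matrix ι κ ℝ} (hAc : IsUnit (coarseMatrix A P)) (v : ι → ℝ) (w : κ → ℝ) :
    ((1 - coarseCorrection A P) *ᵥ v) ⬝ᵥ (A *ᵥ ((1 - coarseCorrection A P) *ᵥ v)) ≤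
      (v - P *ᵥ w) ⬝ᵥ (A *ᵥ (v - P *ᵥ w)) := by
  have hT := PosSemidef_transpose_eq hA
  have hCP := coarseCorrection_mul hAc
  have hn := quad_mul_coarseCorrection_nonneg hA P (v - P *ᵥ w)
  have hsymm := mul_coarseCorrection_transpose hT P
  have hCC : coarseCorrection A P * coarseCorrection A P = coarseCorrection A P := by
    conv_lhs => rhs; rw [coarseCorrection, Matrix.mul_assoc, Matrix.mul_assoc]
    rw [← Matrix.mul_assoc, hCP]
    simp only [coarseCorrection, Matrix.mul_assoc]
  set C := coarseCorrection A P
  -- `I - C` annihilates the range of `P`, so `v` may be replaced by `z = v - P w`. The claim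
  -- becomes `‖z‖_A² - zᵀ A C z ≤ ‖z‖_A²`.
  have hv : (1 - C) *ᵥ v = (1 - C) *ᵥ (v - P *ᵥ w) := by
    rw [mulVec_sub, mulVec_mulVec, Matrix.sub_mul, hCP, Matrix.one_mul, sub_self, zero_mulVec,
      sub_zero]
  rw [hv]
  generalize v - P *ᵥ w = z at hn ⊢
  have hq : (C *ᵥ z) ⬝ᵥ (A *ᵥ (C *ᵥ z)) = z ⬝ᵥ ((A * C) *ᵥ z) := by
    rw [mulVec_dotProduct_mulVec, mulVec_mulVec, mulVec_mulVec, Matrix.mul_assoc]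
    have : Cᵀ * (A * C) = A * C := by
      rw [← Matrix.mul_assoc]
      have h2 : Cᵀ * A = A * C := by rw [← hsymm, transpose_mul, hT]
      rw [h2, Matrix.mul_assoc, hCC]
    rw [this]
  have h1 : (C *ᵥ z) ⬝ᵥ (A *ᵥ z) = z ⬝ᵥ ((A * C) *ᵥ z) := by
    rw [dotProduct_mulVec_comm hT, mulVec_mulVec]
  have h2 : z ⬝ᵥ (A *ᵥ (C *ᵥ z)) = z ⬝ᵥ ((A * C) *ᵥ z) := by rw [mulVec_mulVec]
  rw [sub_mulVec, one_mulVec, mulVec_sub, dotProduct_sub, sub_dotProduct, sub_dotProduct, hq, h1,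
    h2]
  linarith

theorem stability_of_posDef {A : Matrix ι ι ℝ} (hA : A.PosDef) {P : Matrix ι κ ℝ}
    (hAc : IsUnit (coarseMatrix A P)) : Stability A P := by
  intro v
  rw [energyNorm_sq hA.posSemidef, energyNorm_sq hA.posSemidef]
  simpa using quad_one_sub_coarseCorrection_le hA.posSemidef hAc v 0

/-! ### The smoother -/

theorem smoother_posSemidef {A : Matrix ι ι ℝ} (hA : A.PosSemidef) (G : Matrix ι μ ℝ) :
    (smoother A G).PosSemidef := by
  have hc : (Gᵀ * A * G).PosSemidef := by
    simpa using hA.conjTranspose_mul_mul_same G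
  simpa [smoother] using hc.inv.mul_mul_conjTranspose_same G

theorem smoother_mul_mul_smoother (A : Matrix ι ι ℝ) (G : Matrix ι μ ℝ) :
    smoother A G * A * smoother A G = smoother A G := by
  by_cases h : IsUnit (Gᵀ * A * G).det
  · have : smoother A G * A * smoother A G =
        G * ((Gᵀ * A * G)⁻¹ * (Gᵀ * A * G)) * (Gᵀ * A * G)⁻¹ * Gᵀ := by
      simp only [smoother, Matrix.mul_assoc]
    rw [this, nonsing_inv_mul _ h, Matrix.mul_one, smoother]
  -- In the singular case the matrix inverse is `0` by convention, so the identity still holds.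
  · have : smoother A G = 0 := by
      rw [smoother, nonsing_inv_apply_not_isUnit _ h, Matrix.mul_zero, Matrix.zero_mul]
    rw [this, Matrix.mul_zero]

theorem smootherProperty_one {A : Matrix ι ι ℝ} (hA : A.PosDef)
    {𝒢 : (ι → ℝ) → Matrix ι μ ℝ} (h𝒢 : Admissible 𝒢) : SmootherProperty A 𝒢 1 := by
  intro r
  have hB := smoother_posSemidef hA.posSemidef (𝒢 r)
  have hBAB := smoother_mul_mul_smoother A (𝒢 r)
  refine ⟨hB, hBAB, ?_⟩
  by_cases hr : r = 0
  · simp [hr]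
  obtain ⟨hli, y, hy⟩ := h𝒢 r hr
  have hne : Nonempty ι := by
    by_contra hemp
    exact hr (funext fun i => (hemp ⟨i⟩).elim)
  have hT := PosSemidef_transpose_eq hA.posSemidef
  have hBT := PosSemidef_transpose_eq hB
  have hinj : Function.Injective (𝒢 r).mulVec := by
    rw [mulVec_injective_iff]
    exact hli
  have hunit : IsUnit ((𝒢 r)ᵀ * A * 𝒢 r) := by
    have : ((𝒢 r)ᵀ * A * 𝒢 r).PosDef := by simpa using hA.conjTranspose_mul_mul_same hinj
    exact this.isUnit
  have hBAr : smoother A (𝒢 r) *ᵥ (A *ᵥ r) = r := by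
    -- `B A` is the coarse correction for the space spanned by `G`, so it fixes that space.
    have hm : smoother A (𝒢 r) * A * 𝒢 r = 𝒢 r := coarseCorrection_mul (P := 𝒢 r) hunit
    rw [mulVecLin_apply] at hy
    calc _ = (smoother A (𝒢 r) * A * 𝒢 r) *ᵥ y := by simp only [← mulVec_mulVec, hy]
      _ = r := by rw [hm, hy]
  have hρ := rho_pos hA
  have hAr := quad_le_rho hA.1 r
  -- Expanding with `B A r = r` gives `0 ≤ ρ² rᵀ B r - 2 ρ ‖r‖² + rᵀ A r`, and the last term is at
  -- most `ρ ‖r‖²`. Dividing by `ρ` leaves the constant `1`.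
  have hq := PosSemidef_quad_nonneg hB (rho A • r - A *ᵥ r)
  have h3 : (A *ᵥ r) ⬝ᵥ (smoother A (𝒢 r) *ᵥ r) = r ⬝ᵥ r := by
    rw [dotProduct_mulVec_comm hBT, hBAr]
  have h4 : (A *ᵥ r) ⬝ᵥ r = r ⬝ᵥ (A *ᵥ r) := dotProduct_comm _ _
  rw [mulVec_sub, mulVec_smul, hBAr, sub_dotProduct, dotProduct_sub, dotProduct_sub,
    smul_dotProduct, smul_dotProduct, dotProduct_smul, dotProduct_smul, h3, h4] at hq
  simp only [smul_eq_mul] at hq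
  have : 0 ≤ rho A * (rho A * (r ⬝ᵥ (smoother A (𝒢 r) *ᵥ r)) - r ⬝ᵥ r) := by nlinarith
  have := nonneg_of_mul_nonneg_right this hρ
  linarith

/-! ### Convergence -/

theorem energyNorm_sub_step_sq_le {A : Matrix ι ι ℝ} (hA : A.PosDef) {P : Matrix ι κ ℝ}
    (hAc : IsUnit (coarseMatrix A P)) {𝒢 : (ι → ℝ) → Matrix ι μ ℝ} {ca cs : ℝ}
    (hca : 0 < ca) (hcs : 0 < cs) (hδ : 0 ≤ 1 - 1 / (ca * cs)) (happ : Approximation A P ca)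
    (hsm : SmootherProperty A 𝒢 cs) (u u' : ι → ℝ) :
    energyNorm A (u - step A P 𝒢 (A *ᵥ u) u') ^ 2 ≤
      (1 - 1 / (ca * cs)) * energyNorm A (u - u') ^ 2 := by
  have hT := PosSemidef_transpose_eq hA.posSemidef
  set C := coarseCorrection A P with hC
  set e := (1 - C) *ᵥ (u - u') with he
  have hhalf : u - (u' + P *ᵥ ((coarseMatrix A P)⁻¹ *ᵥ (Pᵀ *ᵥ (A *ᵥ u - A *ᵥ u')))) = e := by
    rw [he, sub_mulVec, one_mulVec, hC, coarseCorrection, ← mulVec_sub]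
    simp only [mulVec_mulVec, Matrix.mul_assoc]
    abel
  have hr : A *ᵥ u - A *ᵥ (u' + P *ᵥ ((coarseMatrix A P)⁻¹ *ᵥ (Pᵀ *ᵥ (A *ᵥ u - A *ᵥ u')))) =
      A *ᵥ e := by rw [← mulVec_sub, hhalf]
  obtain ⟨hB, hBAB, hres⟩ := hsm (A *ᵥ e)
  have hstep : u - step A P 𝒢 (A *ᵥ u) u' = e - smoother A (𝒢 (A *ᵥ e)) *ᵥ (A *ᵥ e) := by
    rw [step]
    simp only [hr]
    rw [← sub_sub, hhalf]
  have hBT := PosSemidef_transpose_eq hB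
  rw [hstep]
  set B := smoother A (𝒢 (A *ᵥ e))
  -- Idempotence of `C` lets the approximation property be applied to `e` itself, with `‖e‖_A` on
  -- the left.
  have hCC : (1 - C) *ᵥ e = e := by
    have hCC : C * C = C := by
      have hCP : C * P = P := coarseCorrection_mul hAc
      conv_lhs => rhs; rw [hC, coarseCorrection, Matrix.mul_assoc, Matrix.mul_assoc]
      rw [← Matrix.mul_assoc, hCP, hC]
      simp only [coarseCorrection, Matrix.mul_assoc]
    rw [he, mulVec_mulVec]
    congr 1
    rw [Matrix.mul_sub, Matrix.sub_mul, Matrix.sub_mul, hCC]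
    simp
  have h1 := happ e
  rw [hCC, energyNorm_sq_sq hT] at h1
  have h2 := stability_of_posDef hA hAc (u - u')
  rw [← hC, ← he] at h2
  have hq1 : (B *ᵥ (A *ᵥ e)) ⬝ᵥ (A *ᵥ e) = (A *ᵥ e) ⬝ᵥ (B *ᵥ (A *ᵥ e)) := dotProduct_comm _ _
  have hq2 : e ⬝ᵥ (A *ᵥ (B *ᵥ (A *ᵥ e))) = (A *ᵥ e) ⬝ᵥ (B *ᵥ (A *ᵥ e)) := by
    rw [dotProduct_mulVec_comm hT, dotProduct_comm]
  have hq3 : (B *ᵥ (A *ᵥ e)) ⬝ᵥ (A *ᵥ (B *ᵥ (A *ᵥ e))) = (A *ᵥ e) ⬝ᵥ (B *ᵥ (A *ᵥ e)) := by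
    rw [mulVec_dotProduct_mulVec, hBT]
    rw [show B *ᵥ (A *ᵥ (B *ᵥ (A *ᵥ e))) = (B * A * B) *ᵥ (A *ᵥ e) by
      simp only [mulVec_mulVec, Matrix.mul_assoc], hBAB]
  have hexp : energyNorm A (e - B *ᵥ (A *ᵥ e)) ^ 2 =
      energyNorm A e ^ 2 - (A *ᵥ e) ⬝ᵥ (B *ᵥ (A *ᵥ e)) := by
    rw [energyNorm_sq hA.posSemidef, energyNorm_sq hA.posSemidef, mulVec_sub, dotProduct_sub,
      sub_dotProduct, sub_dotProduct, hq1, hq2, hq3]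
    ring
  rw [hexp]
  have hBnn := PosSemidef_quad_nonneg hB (A *ᵥ e)
  set n := (A *ᵥ e) ⬝ᵥ (A *ᵥ e)
  set b := (A *ᵥ e) ⬝ᵥ (B *ᵥ (A *ᵥ e))
  have hkey : energyNorm A e ^ 2 / (ca * cs) ≤ b := by
    rw [div_le_iff₀ (by positivity)]
    -- The index type may be empty, so `ρ = 0` has to be covered; then `ρ⁻¹ = 0` and the
    -- approximation bound forces the energy of `e` to vanish.
    rcases (rho_nonneg A).eq_or_lt' with h0 | h0
    · rw [h0] at h1
      have : energyNorm A e ^ 2 ≤ 0 := by simpa using h1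
      exact this.trans (by positivity)
    · calc energyNorm A e ^ 2 ≤ ca * (rho A)⁻¹ * n := h1
        _ ≤ ca * (rho A)⁻¹ * (cs * rho A * b) := by gcongr
        _ = b * (ca * cs) := by field_simp
  calc energyNorm A e ^ 2 - b ≤ energyNorm A e ^ 2 - energyNorm A e ^ 2 / (ca * cs) := by linarith
    _ = (1 - 1 / (ca * cs)) * energyNorm A e ^ 2 := by ring
    _ ≤ _ := by gcongr

theorem energyNorm_sub_iterates_le {A : Matrix ι ι ℝ} (hA : A.PosDef) {P : Matrix ι κ ℝ}
    (hAc : IsUnit (coarseMatrix A P)) {𝒢 : (ι → ℝ) → Matrix ι μ ℝ} {ca cs : ℝ}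
    (hca : 0 < ca) (hcs : 0 < cs) (hδ : 0 ≤ 1 - 1 / (ca * cs)) (happ : Approximation A P ca)
    (hsm : SmootherProperty A 𝒢 cs) (u u₀ : ι → ℝ) (t : ℕ) :
    energyNorm A (u - iterates A P 𝒢 (A *ᵥ u) u₀ t) ≤
      (1 - 1 / (ca * cs)) ^ ((t : ℝ) / 2) * energyNorm A (u - u₀) := by
  have hpow : (1 - 1 / (ca * cs)) ^ ((t : ℝ) / 2) = Real.sqrt (1 - 1 / (ca * cs)) ^ t := by
    rw [Real.sqrt_eq_rpow, ← Real.rpow_natCast, ← Real.rpow_mul hδ]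
    ring_nf
  rw [hpow]
  clear hpow
  induction t with
  | zero => simp [iterates]
  | succ t ih =>
    rw [iterates]
    have h := energyNorm_sub_step_sq_le hA hAc hca hcs hδ happ hsm u
      (iterates A P 𝒢 (A *ᵥ u) u₀ t)
    have h' : energyNorm A (u - step A P 𝒢 (A *ᵥ u) (iterates A P 𝒢 (A *ᵥ u) u₀ t)) ≤
        Real.sqrt (1 - 1 / (ca * cs)) * energyNorm A (u - iterates A P 𝒢 (A *ᵥ u) u₀ t) := by
      refine le_of_sq_le_sq ?_ (mul_nonneg (Real.sqrt_nonneg _) (Real.sqrt_nonneg _))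
      rwa [mul_pow, Real.sq_sqrt hδ]
    calc _ ≤ _ := h'
      _ ≤ Real.sqrt (1 - 1 / (ca * cs)) * (Real.sqrt (1 - 1 / (ca * cs)) ^ t *
          energyNorm A (u - u₀)) := by gcongr
      _ = _ := by ring

/-- For nonzero `e` with `Pᵀ A e = 0` the coarse correction does nothing. With `b = (A e)ᵀ B (A e)`,
the two properties give `‖e‖_A² ≤ c_a c_s b`, while `‖e - B A e‖_A² ≥ 0` gives `b ≤ ‖e‖_A²`. -/
theorem one_le_mul_of_approximation {A : Matrix ι ι ℝ} (hA : A.PosDef) {P : Matrix ι κ ℝ}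
    (hcard : Fintype.card κ < Fintype.card ι) {𝒢 : (ι → ℝ) → Matrix ι μ ℝ} {ca cs : ℝ}
    (hca : 0 < ca) (happ : Approximation A P ca) (hsm : SmootherProperty A 𝒢 cs) :
    1 ≤ ca * cs := by
  have hT := PosSemidef_transpose_eq hA.posSemidef
  obtain ⟨e, he0, he⟩ : ∃ e : ι → ℝ, e ≠ 0 ∧ (Pᵀ * A) *ᵥ e = 0 := by
    have h : LinearMap.ker (mulVecLin (Pᵀ * A)) ≠ ⊥ :=
      LinearMap.ker_ne_bot_of_finrank_lt (by simpa using hcard)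
    obtain ⟨e, he, he0⟩ := Submodule.exists_mem_ne_zero_of_ne_bot h
    exact ⟨e, he0, by simpa only [LinearMap.mem_ker, mulVecLin_apply] using he⟩
  have hCe : (1 - coarseCorrection A P) *ᵥ e = e := by
    rw [sub_mulVec, one_mulVec, coarseCorrection, Matrix.mul_assoc, ← mulVec_mulVec, he,
      mulVec_zero, sub_zero]
  have h1 := happ e
  rw [hCe, energyNorm_sq_sq hT, energyNorm_sq hA.posSemidef] at h1
  obtain ⟨hB, hBAB, hres⟩ := hsm (A *ᵥ e)
  have hBT := PosSemidef_transpose_eq hB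
  have hpos := PosDef_quad_pos hA he0
  set B := smoother A (𝒢 (A *ᵥ e))
  have hq := PosSemidef_quad_nonneg hA.posSemidef (e - B *ᵥ (A *ᵥ e))
  have hq1 : (B *ᵥ (A *ᵥ e)) ⬝ᵥ (A *ᵥ e) = (A *ᵥ e) ⬝ᵥ (B *ᵥ (A *ᵥ e)) := dotProduct_comm _ _
  have hq2 : e ⬝ᵥ (A *ᵥ (B *ᵥ (A *ᵥ e))) = (A *ᵥ e) ⬝ᵥ (B *ᵥ (A *ᵥ e)) := by
    rw [dotProduct_mulVec_comm hT, dotProduct_comm]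
  have hq3 : (B *ᵥ (A *ᵥ e)) ⬝ᵥ (A *ᵥ (B *ᵥ (A *ᵥ e))) = (A *ᵥ e) ⬝ᵥ (B *ᵥ (A *ᵥ e)) := by
    rw [mulVec_dotProduct_mulVec, hBT]
    rw [show B *ᵥ (A *ᵥ (B *ᵥ (A *ᵥ e))) = (B * A * B) *ᵥ (A *ᵥ e) by
      simp only [mulVec_mulVec, Matrix.mul_assoc], hBAB]
  rw [mulVec_sub, dotProduct_sub, sub_dotProduct, sub_dotProduct, hq1, hq2, hq3] at hq
  have hne : Nonempty ι := by
    by_contra hemp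
    exact he0 (funext fun i => (hemp ⟨i⟩).elim)
  have hρ := rho_pos hA
  have hBnn := PosSemidef_quad_nonneg hB (A *ᵥ e)
  set n := (A *ᵥ e) ⬝ᵥ (A *ᵥ e)
  set b := (A *ᵥ e) ⬝ᵥ (B *ᵥ (A *ᵥ e))
  set q := e ⬝ᵥ (A *ᵥ e)
  have h2 : q ≤ ca * cs * b := by
    calc q ≤ ca * (rho A)⁻¹ * n := h1
        _ ≤ ca * (rho A)⁻¹ * (cs * rho A * b) := by gcongr
        _ = ca * cs * b := by field_simp
  by_contra! hlt
  have hb : 0 < b := by nlinarith [mul_nonneg (sub_nonneg.2 hlt.le) hBnn]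
  nlinarith [mul_pos (sub_pos.2 hlt) hb]

end General

/-! ### Tensor-product difference operators, interpolation and the approximation property. -/

section OneDim

open scoped Kronecker

/-- The shift matrix. -/
def shift (n : ℕ) : Matrix (Fin n) (Fin n) ℝ :=
  Matrix.of fun i j => if (i : ℤ) + 1 = (j : ℤ) then 1 else 0

/-- The one-dimensional discrete Dirichlet Laplacian `tridiag(-1, 2, -1)`. -/
def lap (n : ℕ) : Matrix (Fin n) (Fin n) ℝ := (2 : ℝ) • 1 - shift n - (shift n)ᵀ

/-- The central difference matrix. -/
def cdiff (n : ℕ) : Matrix (Fin n) (Fin n) ℝ := shift n - (shift n)ᵀ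

/-- The shift is a partial isometry: the defect is the projection onto the first node. It supplies
the boundary terms in the factorizations of `lap`. -/
theorem one_sub_shift_transpose_mul_shift_posSemidef (n : ℕ) :
    (1 - (shift n)ᵀ * shift n).PosSemidef := by
  have h : 1 - (shift n)ᵀ * shift n = diagonal fun i : Fin n => if (i : ℕ) = 0 then 1 else 0 := by
    ext i j
    rw [Matrix.sub_apply, mul_apply, diagonal_apply, Matrix.one_apply]
    simp only [shift, transpose_apply, of_apply]
    by_cases hi : (i : ℕ) = 0
    · rw [Finset.sum_eq_zero fun k _ => by rw [if_neg (by omega), zero_mul]]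
      simp [hi]
    · rw [Finset.sum_eq_single (⟨i - 1, by omega⟩ : Fin n)]
      · simp only [Fin.ext_iff]
        split_ifs <;> first | omega | norm_num
      · intro k _ hk
        rw [if_neg, zero_mul]
        rw [ne_eq, Fin.ext_iff] at hk
        simp at hk
        omega
      · simp
  rw [h]
  exact .diagonal fun i => by simp only [Pi.zero_apply]; split_ifs <;> norm_num

theorem one_sub_shift_mul_shift_transpose_posSemidef (n : ℕ) :
    (1 - shift n * (shift n)ᵀ).PosSemidef := by
  have h : 1 - shift n * (shift n)ᵀ =
      diagonal fun i : Fin n => if (i : ℕ) + 1 = n then 1 else 0 := by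
    ext i j
    rw [Matrix.sub_apply, mul_apply, diagonal_apply, Matrix.one_apply]
    simp only [shift, transpose_apply, of_apply]
    by_cases hi : (i : ℕ) + 1 = n
    · rw [Finset.sum_eq_zero fun k _ => by rw [if_neg (by omega), zero_mul]]
      simp [hi]
    · rw [Finset.sum_eq_single (⟨i + 1, by omega⟩ : Fin n)]
      · simp only [Fin.ext_iff]
        split_ifs <;> first | omega | norm_num
      · intro k _ hk
        rw [if_neg, zero_mul]
        rw [ne_eq, Fin.ext_iff] at hk
        simp at hk
        omega
      · simp
  rw [h]
  exact .diagonal fun i => by simp only [Pi.zero_apply]; split_ifs <;> norm_num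

theorem posSemidef_transpose_mul_self {m n : Type*} [Fintype m] [Fintype n] (F : Matrix m n ℝ) :
    (Fᵀ * F).PosSemidef := by
  simpa using posSemidef_conjTranspose_mul_self F

theorem lap_transpose (n : ℕ) : (lap n)ᵀ = lap n := by
  simp only [lap, transpose_sub, transpose_smul, transpose_one, transpose_transpose]
  abel

theorem isUnit_one_sub_shift (n : ℕ) : IsUnit (1 - shift n) := by
  rw [isUnit_iff_isUnit_det, det_of_isUpperTriangular]
  · simp [shift]
  · intro i j hij
    have hij : j < i := hij
    rw [Matrix.sub_apply, Matrix.one_apply_ne hij.ne']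
    simp only [shift, of_apply]
    rw [if_neg (by rw [Fin.lt_def] at hij; omega), sub_zero]

/-- Summation by parts: a sum of squared differences plus a boundary term. The difference matrix is
unit upper triangular, hence injective. -/
theorem lap_posDef (n : ℕ) : (lap n).PosDef := by
  have h : lap n = (1 - shift n)ᵀ * (1 - shift n) + (1 - (shift n)ᵀ * shift n) := by
    rw [lap, transpose_sub, transpose_one, two_smul]
    noncomm_ring
  rw [h]
  refine PosDef.add_posSemidef ?_ (one_sub_shift_transpose_mul_shift_posSemidef n)
  have := PosDef.conjTranspose_mul_self (1 - shift n)
    (mulVec_injective_of_isUnit (isUnit_one_sub_shift n))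
  rwa [conjTranspose_eq_transpose_of_trivial] at this

theorem four_sub_lap_posSemidef (n : ℕ) : ((4 : ℝ) • 1 - lap n).PosSemidef := by
  have h : (4 : ℝ) • 1 - lap n =
      (1 + shift n)ᵀ * (1 + shift n) + (1 - (shift n)ᵀ * shift n) := by
    rw [lap, transpose_add, transpose_one, ← sub_eq_zero]
    simp only [two_smul, show (4 : ℝ) = 2 * 2 by norm_num, mul_smul]
    noncomm_ring
  rw [h]
  exact (posSemidef_transpose_mul_self _).add (one_sub_shift_transpose_mul_shift_posSemidef n)

/-- Matrix form of `4 (2 - 2 cos θ) = (2 - 2 cos θ)² + (2 sin θ)²`. The last bracket is the boundary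
correction and is positive semidefinite, so `4 L` dominates both `L²` and the square of the central
difference. -/
theorem four_smul_lap_eq (n : ℕ) : (4 : ℝ) • lap n = lap n * lap n + (cdiff n)ᵀ * cdiff n +
    ((2 : ℝ) • (1 - shift n * (shift n)ᵀ) + (2 : ℝ) • (1 - (shift n)ᵀ * shift n)) := by
  simp only [lap, cdiff, transpose_sub, transpose_transpose]
  simp only [two_smul, show (4 : ℝ) = 2 * 2 by norm_num, mul_smul]
  noncomm_ring

theorem four_smul_lap_sub_sq_posSemidef (n : ℕ) :
    ((4 : ℝ) • lap n - lap n * lap n).PosSemidef := by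
  rw [four_smul_lap_eq, add_assoc, add_sub_cancel_left]
  exact (posSemidef_transpose_mul_self _).add
    (((one_sub_shift_mul_shift_transpose_posSemidef n).smul zero_le_two).add
      ((one_sub_shift_transpose_mul_shift_posSemidef n).smul zero_le_two))

theorem four_smul_lap_sub_cdiff_posSemidef (n : ℕ) :
    ((4 : ℝ) • lap n - (cdiff n)ᵀ * cdiff n).PosSemidef := by
  have h := posSemidef_transpose_mul_self (lap n)
  rw [lap_transpose] at h
  rw [four_smul_lap_eq, add_right_comm, add_sub_cancel_right]
  exact h.add (((one_sub_shift_mul_shift_transpose_posSemidef n).smul zero_le_two).add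
      ((one_sub_shift_transpose_mul_shift_posSemidef n).smul zero_le_two))

theorem lap_sq_posSemidef (n : ℕ) : (lap n * lap n).PosSemidef := by
  simpa only [lap_transpose] using posSemidef_transpose_mul_self (lap n)

/-! ### The two-dimensional operators -/

/-- The five-point operator. -/
def lap₂ (n : ℕ) : Matrix (Fin n × Fin n) (Fin n × Fin n) ℝ := lap n ⊗ₖ 1 + 1 ⊗ₖ lap n

/-- The one-parameter family of consistent symmetric nine-point operators. -/
def ninePointMatrix (n : ℕ) (γ : ℝ) : Matrix (Fin n × Fin n) (Fin n × Fin n) ℝ :=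
  lap₂ n + γ • (lap n ⊗ₖ lap n)

theorem lap₂_posDef (n : ℕ) : (lap₂ n).PosDef :=
  ((lap_posDef n).kronecker .one).add (PosDef.one.kronecker (lap_posDef n))

theorem kronecker_lap_posSemidef (n : ℕ) : (lap n ⊗ₖ lap n).PosSemidef :=
  (lap_posDef n).posSemidef.kronecker (lap_posDef n).posSemidef

theorem lap₂_transpose (n : ℕ) : (lap₂ n)ᵀ = lap₂ n :=
  PosSemidef_transpose_eq (lap₂_posDef n).posSemidef

theorem sub_kronecker {l m n p : Type*} (A A' : Matrix l m ℝ) (B : Matrix n p ℝ) :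
    (A - A') ⊗ₖ B = A ⊗ₖ B - A' ⊗ₖ B := by
  ext; simp [kroneckerMap_apply, sub_mul]

theorem kronecker_sub {l m n p : Type*} (A : Matrix l m ℝ) (B B' : Matrix n p ℝ) :
    A ⊗ₖ (B - B') = A ⊗ₖ B - A ⊗ₖ B' := by
  ext; simp [kroneckerMap_apply, mul_sub]

theorem eight_sub_lap₂_posSemidef (n : ℕ) : ((8 : ℝ) • 1 - lap₂ n).PosSemidef := by
  have h : (8 : ℝ) • 1 - lap₂ n = ((4 : ℝ) • 1 - lap n) ⊗ₖ 1 + 1 ⊗ₖ ((4 : ℝ) • 1 - lap n) := by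
    rw [lap₂, sub_kronecker, kronecker_sub, smul_kronecker, kronecker_smul, one_kronecker_one]
    module
  rw [h]
  exact ((four_sub_lap_posSemidef n).kronecker .one).add
    (PosSemidef.one.kronecker (four_sub_lap_posSemidef n))

/-- This is the origin of the threshold `-1/2`: since `0 ≤ L ≤ 4`, the mixed term `L ⊗ L` is at most
twice the five-point operator. -/
theorem two_smul_lap₂_sub_eq (n : ℕ) : (2 : ℝ) • lap₂ n - lap n ⊗ₖ lap n =
    (1 / 2 : ℝ) • (lap n ⊗ₖ ((4 : ℝ) • 1 - lap n) + ((4 : ℝ) • 1 - lap n) ⊗ₖ lap n) := by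
  rw [lap₂, sub_kronecker, kronecker_sub, smul_kronecker, kronecker_smul]
  module

theorem two_smul_lap₂_sub_posSemidef (n : ℕ) :
    ((2 : ℝ) • lap₂ n - lap n ⊗ₖ lap n).PosSemidef := by
  rw [two_smul_lap₂_sub_eq]
  exact (((lap_posDef n).posSemidef.kronecker (four_sub_lap_posSemidef n)).add
    ((four_sub_lap_posSemidef n).kronecker (lap_posDef n).posSemidef)).smul (by norm_num)

theorem lap₂_mul_kronecker_posSemidef (n : ℕ) : (lap₂ n * (lap n ⊗ₖ lap n)).PosSemidef := by
  rw [lap₂, Matrix.add_mul, ← mul_kronecker_mul, ← mul_kronecker_mul, Matrix.one_mul]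
  exact ((lap_sq_posSemidef n).kronecker (lap_posDef n).posSemidef).add
    ((lap_posDef n).posSemidef.kronecker (lap_sq_posSemidef n))

/-- The product expands into tensor products of the polynomials `L`, `L²`, `4 - L` and `4 L - L²` in
`L`, each positive semidefinite. -/
theorem lap₂_mul_two_smul_lap₂_sub_posSemidef (n : ℕ) :
    (lap₂ n * ((2 : ℝ) • lap₂ n - lap n ⊗ₖ lap n)).PosSemidef := by
  have h : lap₂ n * ((2 : ℝ) • lap₂ n - lap n ⊗ₖ lap n) = (1 / 2 : ℝ) •
      ((lap n * lap n) ⊗ₖ ((4 : ℝ) • 1 - lap n) + ((4 : ℝ) • lap n - lap n * lap n) ⊗ₖ lap n +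
      (lap n ⊗ₖ ((4 : ℝ) • lap n - lap n * lap n) +
        ((4 : ℝ) • 1 - lap n) ⊗ₖ (lap n * lap n))) := by
    have h1 : lap n * ((4 : ℝ) • 1 - lap n) = (4 : ℝ) • lap n - lap n * lap n := by
      rw [Matrix.mul_sub, Matrix.mul_smul, Matrix.mul_one]
    rw [two_smul_lap₂_sub_eq, lap₂, Matrix.mul_smul, Matrix.add_mul, Matrix.mul_add,
      Matrix.mul_add]
    simp only [← mul_kronecker_mul, Matrix.one_mul, h1]
  rw [h]
  exact ((((lap_sq_posSemidef n).kronecker (four_sub_lap_posSemidef n)).add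
    ((four_smul_lap_sub_sq_posSemidef n).kronecker (lap_posDef n).posSemidef)).add
    (((lap_posDef n).posSemidef.kronecker (four_smul_lap_sub_sq_posSemidef n)).add
    ((four_sub_lap_posSemidef n).kronecker (lap_sq_posSemidef n)))).smul (by norm_num)

/-- In the expansion of the square the cross term is `2 a b vᵀ S Q v ≥ 0`, so only `a² ‖S v‖²` need
be kept. -/
theorem sq_mul_le_of_posSemidef_mul {ι : Type} [Fintype ι] [DecidableEq ι] {S Q : Matrix ι ι ℝ}
    (hS : Sᵀ = S) (h : (S * Q).PosSemidef) {a b : ℝ} (ha : 0 ≤ a) (hb : 0 ≤ b) (v : ι → ℝ) :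
    a ^ 2 * ((S *ᵥ v) ⬝ᵥ (S *ᵥ v)) ≤
      ((a • S + b • Q) *ᵥ v) ⬝ᵥ ((a • S + b • Q) *ᵥ v) := by
  have h1 := PosSemidef_quad_nonneg h v
  have h2 : (S *ᵥ v) ⬝ᵥ (Q *ᵥ v) = v ⬝ᵥ ((S * Q) *ᵥ v) := by
    rw [mulVec_dotProduct_mulVec, hS, mulVec_mulVec]
  have h3 := dotProduct_self_nonneg' (Q *ᵥ v)
  rw [add_mulVec, smul_mulVec, smul_mulVec, dotProduct_add, add_dotProduct, add_dotProduct]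
  simp only [smul_dotProduct, dotProduct_smul, smul_eq_mul, dotProduct_comm (Q *ᵥ v) (S *ᵥ v), h2]
  have h4 : 0 ≤ a * b * (v ⬝ᵥ ((S * Q) *ᵥ v)) := by positivity
  have h5 : 0 ≤ b ^ 2 * ((Q *ᵥ v) ⬝ᵥ (Q *ᵥ v)) := by positivity
  linarith

/-- For `γ > -1/2` the nine-point operators are uniformly equivalent to the five-point operator. -/
theorem ninePointMatrix_bounds {γ : ℝ} (hγ : -(1 / 2) < γ) :
    ∃ a b : ℝ, 0 < a ∧ 0 < b ∧ ∀ n : ℕ, (ninePointMatrix n γ).PosDef ∧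
      (b • 1 - ninePointMatrix n γ).PosSemidef ∧
      ∀ v, a * ((lap₂ n *ᵥ v) ⬝ᵥ (lap₂ n *ᵥ v)) ≤
        (ninePointMatrix n γ *ᵥ v) ⬝ᵥ (ninePointMatrix n γ *ᵥ v) := by
  rcases le_total 0 γ with h0 | h0
  -- The upper bound combines `lap₂ ≤ 8` with `L ⊗ L ≤ 2 lap₂`.
  · refine ⟨1 ^ 2, 8 * (1 + 2 * γ), by norm_num, by positivity, fun n => ⟨?_, ?_, fun v => ?_⟩⟩
    · exact (lap₂_posDef n).add_posSemidef ((kronecker_lap_posSemidef n).smul h0)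
    · have h : (8 * (1 + 2 * γ)) • 1 - ninePointMatrix n γ =
          (1 + 2 * γ) • ((8 : ℝ) • 1 - lap₂ n) + γ • ((2 : ℝ) • lap₂ n - lap n ⊗ₖ lap n) := by
        rw [ninePointMatrix]
        module
      rw [h]
      exact ((eight_sub_lap₂_posSemidef n).smul (by linarith)).add
        ((two_smul_lap₂_sub_posSemidef n).smul h0)
    · have h := sq_mul_le_of_posSemidef_mul (lap₂_transpose n) (lap₂_mul_kronecker_posSemidef n)
        zero_le_one h0 v
      rwa [one_smul] at h
  · have hp : 0 < 1 + 2 * γ := by linarith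
    -- For `γ ≤ 0` the operator is rewritten as a nonnegative combination of positive operators,
    -- with a strictly positive share `1 + 2 γ` of `lap₂`.
    have he : ∀ n, ninePointMatrix n γ =
        (1 + 2 * γ) • lap₂ n + (-γ) • ((2 : ℝ) • lap₂ n - lap n ⊗ₖ lap n) := fun n => by
      rw [ninePointMatrix]
      module
    refine ⟨(1 + 2 * γ) ^ 2, 8, by positivity, by norm_num, fun n => ⟨?_, ?_, fun v => ?_⟩⟩
    · rw [he]
      exact ((lap₂_posDef n).smul hp).add_posSemidef
        ((two_smul_lap₂_sub_posSemidef n).smul (by linarith))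
    · have h : (8 : ℝ) • 1 - ninePointMatrix n γ =
          ((8 : ℝ) • 1 - lap₂ n) + (-γ) • (lap n ⊗ₖ lap n) := by
        rw [ninePointMatrix]
        module
      rw [h]
      exact (eight_sub_lap₂_posSemidef n).add ((kronecker_lap_posSemidef n).smul (by linarith))
    · rw [he]
      exact sq_mul_le_of_posSemidef_mul (lap₂_transpose n)
        (lap₂_mul_two_smul_lap₂_sub_posSemidef n) hp.le (by linarith) v

/-! ### Discrete `H²` bounds -/

/-- Tensor products are monotone on positive semidefinite matrices, so `Fᵀ F ≤ 4 L` can be squared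
by telescoping. It is applied to `F = lap n` and `F = cdiff n`. -/
theorem kronecker_self_le {n : ℕ} {F : Matrix (Fin n) (Fin n) ℝ}
    (hF : ((4 : ℝ) • lap n - Fᵀ * F).PosSemidef) (v : Fin n × Fin n → ℝ) :
    ((F ⊗ₖ F) *ᵥ v) ⬝ᵥ ((F ⊗ₖ F) *ᵥ v) ≤ 16 * (v ⬝ᵥ ((lap n ⊗ₖ lap n) *ᵥ v)) := by
  have h : (16 : ℝ) • (lap n ⊗ₖ lap n) - (F ⊗ₖ F)ᵀ * (F ⊗ₖ F) =
      ((4 : ℝ) • lap n - Fᵀ * F) ⊗ₖ ((4 : ℝ) • lap n) +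
        (Fᵀ * F) ⊗ₖ ((4 : ℝ) • lap n - Fᵀ * F) := by
    have hT : (F ⊗ₖ F)ᵀ = Fᵀ ⊗ₖ Fᵀ := rfl
    rw [hT, ← mul_kronecker_mul, sub_kronecker, kronecker_sub, smul_kronecker, kronecker_smul,
      kronecker_smul]
    module
  have hp : ((16 : ℝ) • (lap n ⊗ₖ lap n) - (F ⊗ₖ F)ᵀ * (F ⊗ₖ F)).PosSemidef := by
    rw [h]
    exact (hF.kronecker ((lap_posDef n).posSemidef.smul (by norm_num))).add
      ((posSemidef_transpose_mul_self F).kronecker hF)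
  have hq := PosSemidef_quad_nonneg hp v
  rw [sub_mulVec, dotProduct_sub, smul_mulVec, dotProduct_smul, ← mulVec_mulVec,
    ← mulVec_dotProduct_mulVec, smul_eq_mul] at hq
  linarith

/-- Discrete form of `‖Δv‖² = ‖v_xx‖² + ‖v_yy‖² + 2 ‖v_xy‖²`. All three terms are nonnegative, so
the Laplacian controls each second difference. -/
theorem lap₂_sq_eq (n : ℕ) (v : Fin n × Fin n → ℝ) :
    (lap₂ n *ᵥ v) ⬝ᵥ (lap₂ n *ᵥ v) =
      ((lap n ⊗ₖ (1 : Matrix (Fin n) (Fin n) ℝ)) *ᵥ v) ⬝ᵥ ((lap n ⊗ₖ 1) *ᵥ v) +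
        (((1 : Matrix (Fin n) (Fin n) ℝ) ⊗ₖ lap n) *ᵥ v) ⬝ᵥ ((1 ⊗ₖ lap n) *ᵥ v) +
        2 * (v ⬝ᵥ ((lap n ⊗ₖ lap n) *ᵥ v)) := by
  have h : ((lap n ⊗ₖ (1 : Matrix (Fin n) (Fin n) ℝ)) *ᵥ v) ⬝ᵥ ((1 ⊗ₖ lap n) *ᵥ v) =
      v ⬝ᵥ ((lap n ⊗ₖ lap n) *ᵥ v) := by
    have hT : (lap n ⊗ₖ (1 : Matrix (Fin n) (Fin n) ℝ))ᵀ = (lap n)ᵀ ⊗ₖ 1ᵀ := rfl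
    rw [mulVec_dotProduct_mulVec, mulVec_mulVec, hT, lap_transpose, transpose_one,
      ← mul_kronecker_mul, Matrix.mul_one, Matrix.one_mul]
  rw [lap₂, add_mulVec, dotProduct_add, add_dotProduct, add_dotProduct,
    dotProduct_comm ((1 ⊗ₖ lap n) *ᵥ v) ((lap n ⊗ₖ 1) *ᵥ v), h]
  ring

theorem diagonal_mulVec_sq_le {ι : Type} [Fintype ι] [DecidableEq ι] {d : ι → ℝ}
    (hd : ∀ i, |d i| ≤ 1) (v : ι → ℝ) :
    (diagonal d *ᵥ v) ⬝ᵥ (diagonal d *ᵥ v) ≤ v ⬝ᵥ v := by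
  refine Finset.sum_le_sum fun i _ => ?_
  rw [mulVec_diagonal]
  have := (sq_le_one_iff_abs_le_one _).2 (hd i)
  nlinarith [sq_nonneg (v i)]

theorem add_dotProduct_self_le {ι : Type} [Fintype ι] (a b c d : ι → ℝ) :
    (a + b + c + d) ⬝ᵥ (a + b + c + d) ≤ 4 * (a ⬝ᵥ a + b ⬝ᵥ b + c ⬝ᵥ c + d ⬝ᵥ d) := by
  simp only [dotProduct, ← Finset.sum_add_distrib, Finset.mul_sum, Pi.add_apply]
  refine Finset.sum_le_sum fun i _ => ?_
  nlinarith [sq_nonneg (a i - b i), sq_nonneg (a i - c i), sq_nonneg (a i - d i),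
    sq_nonneg (b i - c i), sq_nonneg (b i - d i), sq_nonneg (c i - d i)]

/-! ### Interpolation in one dimension -/

/-- The matrix with entries `f (i - 2 j)` in terms of the node coordinates. -/
def coarseStencil (f : ℤ → ℝ) (M : ℕ) : Matrix (Fin (2 * M - 1)) (Fin (M - 1)) ℝ :=
  Matrix.of fun i q => f ((i : ℤ) + 1 - 2 * ((q : ℤ) + 1))

/-- Injection of fine grid functions to the coarse grid. -/
def injection (M : ℕ) : Matrix (Fin (M - 1)) (Fin (2 * M - 1)) ℝ :=
  Matrix.of fun q i => if (i : ℤ) + 1 = 2 * ((q : ℤ) + 1) then 1 else 0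

/-- Linear interpolation weights. -/
def linWeight (d : ℤ) : ℝ := 
  if d = 0 then 1 else if d = 1 ∨ d = -1 then 1 / 2 else 0

/-- Odd weights. -/
def oddWeight (d : ℤ) : ℝ := if d = 1 then 1 else if d = -1 then -1 else 0

/-- Half the projection onto the fine nodes that are not coarse nodes. -/
def oddHalf (M : ℕ) : Fin (2 * M - 1) → ℝ := fun i => if Even (i : ℕ) then 1 / 2 else 0

/-- The index `j` has coordinate `j + 1`: even indices are the nodes missing from the coarse grid,
and their values are discarded. -/
theorem coarseStencil_mul_injection (f : ℤ → ℝ) (M : ℕ) (i j : Fin (2 * M - 1)) :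
    (coarseStencil f M * injection M) i j = if Even (j : ℕ) then 0 else f ((i : ℤ) - j) := by
  rw [mul_apply]
  simp only [coarseStencil, injection, of_apply]
  split_ifs with h
  · refine Finset.sum_eq_zero fun q _ => ?_
    rw [if_neg, mul_zero]
    obtain ⟨k, hk⟩ := h
    omega
  · obtain ⟨k, hk⟩ := Nat.not_even_iff_odd.1 h
    have hj := j.2
    rw [Finset.sum_eq_single (⟨k, by omega⟩ : Fin (M - 1))]
    · rw [if_pos (by push_cast; omega), mul_one]
      congr 1
      push_cast
      omega
    · intro q _ hq
      rw [if_neg, mul_zero]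
      rw [ne_eq, Fin.ext_iff] at hq
      simp at hq
      omega
    · simp

theorem injection_mul_coarseStencil (f : ℤ → ℝ) (M : ℕ) (q q' : Fin (M - 1)) :
    (injection M * coarseStencil f M) q q' = f (2 * ((q : ℤ) - q')) := by
  rw [mul_apply]
  simp only [coarseStencil, injection, of_apply]
  have hq := q.2
  rw [Finset.sum_eq_single (⟨2 * q + 1, by omega⟩ : Fin (2 * M - 1))]
  · rw [if_pos (by push_cast; omega), one_mul]
    congr 1
    push_cast
    omega
  · intro i _ hi
    rw [if_neg, zero_mul]
    rw [ne_eq, Fin.ext_iff] at hi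
    simp at hi
    omega
  · simp

theorem lap_apply (n : ℕ) (i j : Fin n) : lap n i j =
    if (i : ℕ) = j then 2 else if (i : ℕ) + 1 = j ∨ (j : ℕ) + 1 = i then -1 else 0 := by
  simp only [lap, shift, Matrix.sub_apply, Matrix.smul_apply, Matrix.one_apply, transpose_apply, of_apply, Fin.ext_iff,
    smul_eq_mul]
  split_ifs <;> first | omega | norm_num

/-- At a node between two coarse ones interpolation returns the mean of the neighbours, which is `v
- (1/2) L v`; at coarse nodes it is exact. Zero boundary values make this valid at the ends too. -/
theorem linear_mul_injection (M : ℕ) :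
    coarseStencil linWeight M * injection M = 1 - diagonal (oddHalf M) * lap (2 * M - 1) := by
  ext i j
  rw [coarseStencil_mul_injection, Matrix.sub_apply, diagonal_mul, lap_apply, Matrix.one_apply]
  simp only [Fin.ext_iff, linWeight, oddHalf, Nat.even_iff]
  split_ifs <;> first | omega | norm_num

theorem odd_mul_injection (M : ℕ) :
    coarseStencil oddWeight M * injection M =
      (-2 : ℝ) • (diagonal (oddHalf M) * cdiff (2 * M - 1)) := by
  ext i j
  rw [coarseStencil_mul_injection, Matrix.smul_apply, diagonal_mul]
  simp only [cdiff, shift, Matrix.sub_apply, transpose_apply, of_apply, oddWeight, oddHalf, Nat.even_iff,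
    smul_eq_mul]
  split_ifs <;> first | omega | norm_num

theorem injection_mul_linear (M : ℕ) : injection M * coarseStencil linWeight M = 1 := by
  ext q q'
  rw [injection_mul_coarseStencil, Matrix.one_apply]
  simp only [linWeight, Fin.ext_iff]
  split_ifs <;> first | omega | norm_num

theorem injection_mul_odd (M : ℕ) : injection M * coarseStencil oddWeight M = 0 := by
  ext q q'
  rw [injection_mul_coarseStencil, Matrix.zero_apply]
  simp only [oddWeight]
  split_ifs <;> first | omega | norm_num

/-! ### The prolongations -/

theorem ninePoint_stencil_eq (a b : ℤ) :
    Prolongation.ninePoint.stencil a b = linWeight a * linWeight b := by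
  have h1 : |a| + |b| = 1 ↔ (a = 0 ∧ (b = 1 ∨ b = -1)) ∨ (b = 0 ∧ (a = 1 ∨ a = -1)) := by
    rw [abs_eq_max_neg, abs_eq_max_neg]; omega
  have h2 : |a| = 1 ∧ |b| = 1 ↔ (a = 1 ∨ a = -1) ∧ (b = 1 ∨ b = -1) := by
    rw [abs_eq_max_neg, abs_eq_max_neg]; omega
  simp only [Prolongation.stencil, linWeight, h1, h2]
  split_ifs <;> first | omega | norm_num

/-- The two stencils differ only at the corners, where `1/4` becomes `1/2` along one diagonal and
`0` along the other; the odd tensor product is exactly this perturbation. -/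
theorem sevenPoint_stencil_eq (a b : ℤ) : Prolongation.sevenPoint.stencil a b =
    linWeight a * linWeight b + 1 / 4 * (oddWeight a * oddWeight b) := by
  have h : (|a| ≤ 1 ∧ |b| ≤ 1 ∧ |a - b| ≤ 1) ↔
      (-1 ≤ a ∧ a ≤ 1) ∧ (-1 ≤ b ∧ b ≤ 1) ∧ (-1 ≤ a - b ∧ a - b ≤ 1) := by
    simp only [abs_le]
  simp only [Prolongation.stencil, linWeight, oddWeight, h]
  split_ifs <;> first | omega | norm_num

theorem ninePoint_matrix_eq (M : ℕ) : Prolongation.ninePoint.matrix M =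
    coarseStencil linWeight M ⊗ₖ coarseStencil linWeight M := by
  ext p q
  exact ninePoint_stencil_eq _ _

theorem sevenPoint_matrix_eq (M : ℕ) : Prolongation.sevenPoint.matrix M =
    coarseStencil linWeight M ⊗ₖ coarseStencil linWeight M +
      (1 / 4 : ℝ) • (coarseStencil oddWeight M ⊗ₖ coarseStencil oddWeight M) := by
  ext p q
  exact sevenPoint_stencil_eq _ _

theorem prolongation_decomposition (π : Prolongation) : ∃ ε : ℝ, |ε| ≤ 1 ∧ ∀ M : ℕ,
    π.matrix M = coarseStencil linWeight M ⊗ₖ coarseStencil linWeight M +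
      (ε / 4 : ℝ) • (coarseStencil oddWeight M ⊗ₖ coarseStencil oddWeight M) := by
  cases π with
  | sevenPoint => exact ⟨1, by simp, sevenPoint_matrix_eq⟩
  | ninePoint => exact ⟨0, by simp, fun M => by simp [ninePoint_matrix_eq]⟩

theorem injection_mul_prolongation (π : Prolongation) (M : ℕ) :
    (injection M ⊗ₖ injection M) * π.matrix M = 1 := by
  obtain ⟨ε, -, h⟩ := prolongation_decomposition π
  rw [h, Matrix.mul_add, Matrix.mul_smul, ← mul_kronecker_mul, ← mul_kronecker_mul,
    injection_mul_linear, injection_mul_odd]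
  simp

theorem prolongation_injective (π : Prolongation) (M : ℕ) :
    Function.Injective (π.matrix M).mulVec := by
  intro v w h
  have h' : (injection M ⊗ₖ injection M) *ᵥ (π.matrix M *ᵥ v) =
    (injection M ⊗ₖ injection M) *ᵥ (π.matrix M *ᵥ w) := congrArg _ h
  simpa only [mulVec_mulVec, injection_mul_prolongation, one_mulVec] using h'

/-- The interpolation error is bounded by the discrete Laplacian. -/
theorem interpolation_error_le (π : Prolongation) (M : ℕ) (v : Node (2 * M) → ℝ) :
    (v - π.matrix M *ᵥ ((injection M ⊗ₖ injection M) *ᵥ v)) ⬝ᵥ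
        (v - π.matrix M *ᵥ ((injection M ⊗ₖ injection M) *ᵥ v)) ≤
      64 * ((lap₂ (2 * M - 1) *ᵥ v) ⬝ᵥ (lap₂ (2 * M - 1) *ᵥ v)) := by
  obtain ⟨ε, hε, h⟩ := prolongation_decomposition π
  set n := 2 * M - 1
  set T := diagonal (oddHalf M) with hT
  -- This expands `(1 - T L) ⊗ (1 - T L)`; the odd part contributes `(ε / 4) (-2)² = ε` times `T D ⊗
  -- T D`, with `D` the central difference.
  have hPJ : π.matrix M * (injection M ⊗ₖ injection M) =
      1 - (T ⊗ₖ (1 : Matrix (Fin n) (Fin n) ℝ)) * (lap n ⊗ₖ 1) -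
        ((1 : Matrix (Fin n) (Fin n) ℝ) ⊗ₖ T) * (1 ⊗ₖ lap n) + (T ⊗ₖ T) * (lap n ⊗ₖ lap n) +
        (ε • T ⊗ₖ T) * (cdiff n ⊗ₖ cdiff n) := by
    rw [h, Matrix.add_mul, smul_mul, ← mul_kronecker_mul, ← mul_kronecker_mul,
      linear_mul_injection, odd_mul_injection, ← mul_kronecker_mul, ← mul_kronecker_mul,
      ← mul_kronecker_mul, smul_mul, ← mul_kronecker_mul, sub_kronecker, kronecker_sub,
      kronecker_sub, smul_kronecker, kronecker_smul, one_kronecker_one, Matrix.one_mul]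
    module
  have he : v - π.matrix M *ᵥ ((injection M ⊗ₖ injection M) *ᵥ v) =
      (T ⊗ₖ (1 : Matrix (Fin n) (Fin n) ℝ)) *ᵥ ((lap n ⊗ₖ 1) *ᵥ v) +
        ((1 : Matrix (Fin n) (Fin n) ℝ) ⊗ₖ T) *ᵥ ((1 ⊗ₖ lap n) *ᵥ v) +
        (-(T ⊗ₖ T)) *ᵥ ((lap n ⊗ₖ lap n) *ᵥ v) +
        (-(ε • T ⊗ₖ T)) *ᵥ ((cdiff n ⊗ₖ cdiff n) *ᵥ v) := by
    rw [mulVec_mulVec, hPJ]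
    simp only [add_mulVec, sub_mulVec, neg_mulVec, one_mulVec, ← mulVec_mulVec]
    abel
  have hodd : ∀ i, |oddHalf M i| ≤ 1 := fun i => by
    simp only [oddHalf]; split_ifs <;> norm_num [abs_of_pos]
  have h1 : ∀ w, ((T ⊗ₖ (1 : Matrix (Fin n) (Fin n) ℝ)) *ᵥ w) ⬝ᵥ ((T ⊗ₖ 1) *ᵥ w) ≤ w ⬝ᵥ w := by
    rw [← diagonal_one, diagonal_kronecker_diagonal]
    exact diagonal_mulVec_sq_le fun i => by simpa using hodd i.1
  have h2 : ∀ w, (((1 : Matrix (Fin n) (Fin n) ℝ) ⊗ₖ T) *ᵥ w) ⬝ᵥ ((1 ⊗ₖ T) *ᵥ w) ≤ w ⬝ᵥ w := by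
    rw [← diagonal_one, diagonal_kronecker_diagonal]
    exact diagonal_mulVec_sq_le fun i => by simpa using hodd i.2
  have h3 : ∀ w, ((-(T ⊗ₖ T)) *ᵥ w) ⬝ᵥ ((-(T ⊗ₖ T)) *ᵥ w) ≤ w ⬝ᵥ w := by
    intro w
    rw [neg_mulVec, neg_dotProduct_neg, diagonal_kronecker_diagonal]
    exact diagonal_mulVec_sq_le (fun i => by
      rw [abs_mul]; exact mul_le_one₀ (hodd _) (abs_nonneg _) (hodd _)) w
  have h4 : ∀ w, ((-(ε • T ⊗ₖ T)) *ᵥ w) ⬝ᵥ ((-(ε • T ⊗ₖ T)) *ᵥ w) ≤ w ⬝ᵥ w := by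
    intro w
    rw [neg_mulVec, neg_dotProduct_neg, diagonal_kronecker_diagonal, ← diagonal_smul]
    refine diagonal_mulVec_sq_le (fun i => ?_) w
    simp only [Pi.smul_apply, smul_eq_mul, abs_mul]
    exact mul_le_one₀ hε (by positivity) (mul_le_one₀ (hodd _) (abs_nonneg _) (hodd _))
  rw [he]
  refine (add_dotProduct_self_le _ _ _ _).trans ?_
  have hl : ((4 : ℝ) • lap n - (lap n)ᵀ * lap n).PosSemidef := by
    rw [lap_transpose]; exact four_smul_lap_sub_sq_posSemidef n
  have k1 := kronecker_self_le hl v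
  have k2 := kronecker_self_le (four_smul_lap_sub_cdiff_posSemidef n) v
  have k3 := h1 ((lap n ⊗ₖ 1) *ᵥ v)
  have k4 := h2 ((1 ⊗ₖ lap n) *ᵥ v)
  have k5 := h3 ((lap n ⊗ₖ lap n) *ᵥ v)
  have k6 := h4 ((cdiff n ⊗ₖ cdiff n) *ᵥ v)
  have k7 := dotProduct_self_nonneg' ((lap n ⊗ₖ (1 : Matrix (Fin n) (Fin n) ℝ)) *ᵥ v)
  have k8 := dotProduct_self_nonneg' (((1 : Matrix (Fin n) (Fin n) ℝ) ⊗ₖ lap n) *ᵥ v)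
  -- With `x = vᵀ (L ⊗ L) v`, the four terms sum to at most `4 (‖v_xx‖² + ‖v_yy‖² + 16 x + 16 x)`.
  -- Matching `128 x` with the `2 x` in the identity gives `64`.
  rw [lap₂_sq_eq]
  linarith

theorem smul_posDef_and_coarse {γ s : ℝ} (hγ : -(1 / 2) < γ) (hs : 0 < s)
    (π : Prolongation) (M : ℕ) :
    (s • ninePointMatrix (2 * M - 1) γ).PosDef ∧
      (coarseMatrix (s • ninePointMatrix (2 * M - 1) γ) (π.matrix M)).PosDef := by
  obtain ⟨a, b, -, -, h⟩ := ninePointMatrix_bounds hγ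
  have hA := ((h (2 * M - 1)).1).smul hs
  exact ⟨hA, coarseMatrix_posDef hA (prolongation_injective π M)⟩

theorem approximation_ninePointMatrix {γ : ℝ} (hγ : -(1 / 2) < γ) :
    ∃ ca : ℝ, 0 < ca ∧ ∀ (s : ℝ), 0 < s → ∀ (π : Prolongation) (M : ℕ), 1 ≤ M →
      Approximation (s • ninePointMatrix (2 * M - 1) γ) (π.matrix M) ca := by
  obtain ⟨a, b, ha, hb, h⟩ := ninePointMatrix_bounds hγ
  -- The factors are `64` from interpolation, `1 / a` from the lower bound, one `b` from the energy
  -- of the interpolation error and one from `ρ ≤ s b`. The scaling `s` cancels, hence mesh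
  -- independence.
  refine ⟨64 * b ^ 2 / a, by positivity, fun s hs π M hM v => ?_⟩
  obtain ⟨hA, hAc⟩ := smul_posDef_and_coarse hγ hs π M
  obtain ⟨-, hbd, hlow⟩ := h (2 * M - 1)
  have : Nonempty (Node (2 * M)) := ⟨(⟨0, by omega⟩, ⟨0, by omega⟩)⟩
  have hρ : 0 < rho (s • ninePointMatrix (2 * M - 1) γ) := rho_pos (ι := Node (2 * M)) hA
  have hbd' : ((s * b) • 1 - s • ninePointMatrix (2 * M - 1) γ).PosSemidef := by
    have := hbd.smul hs.le
    rwa [smul_sub, smul_smul] at this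
  have hρ' := rho_le_of_posSemidef (by positivity) hA.posSemidef hbd'
  have hlow := hlow v
  rw [energyNorm_sq hA.posSemidef, energyNorm_sq_sq (PosSemidef_transpose_eq hA.posSemidef)]
  refine (quad_one_sub_coarseCorrection_le hA.posSemidef hAc.isUnit v
    ((injection M ⊗ₖ injection M) *ᵥ v)).trans ?_
  have hint := interpolation_error_le π M v
  set e := v - π.matrix M *ᵥ ((injection M ⊗ₖ injection M) *ᵥ v)
  have hq := PosSemidef_quad_nonneg hbd' e
  rw [sub_mulVec, dotProduct_sub, smul_mulVec, dotProduct_smul, one_mulVec, smul_eq_mul,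
    sub_nonneg] at hq
  refine hq.trans ?_
  rw [smul_mulVec, smul_dotProduct, dotProduct_smul, smul_eq_mul, smul_eq_mul]
  set ℓ := (lap₂ (2 * M - 1) *ᵥ v) ⬝ᵥ (lap₂ (2 * M - 1) *ᵥ v)
  set m := (ninePointMatrix (2 * M - 1) γ *ᵥ v) ⬝ᵥ (ninePointMatrix (2 * M - 1) γ *ᵥ v)
  have hm : 0 ≤ m := dotProduct_self_nonneg' _
  calc s * b * (e ⬝ᵥ e) ≤ s * b * (64 * (m / a)) := by
        gcongr
        refine hint.trans ?_
        gcongr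
        rw [le_div_iff₀ ha]
        linarith
    _ = 64 * b ^ 2 / a * (s * b)⁻¹ * (s * (s * m)) := by field_simp
    _ ≤ _ := by gcongr

end OneDim

/-! ### Identification of the finite difference matrices; reduction of stiffness entries to plane
integrals. -/

section Schemes

open scoped Kronecker

/-- The entries of `tridiag(-1, 2, -1)` as a function of the offset. -/
def lapWeight (d : ℤ) : ℝ := if d = 0 then 2 else if d = 1 ∨ d = -1 then -1 else 0

theorem lap_apply_eq_lapWeight {n : ℕ} (i j : Fin n) : lap n i j = lapWeight ((j : ℤ) - i) := by
  rw [lap_apply]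
  simp only [lapWeight]
  split_ifs <;> first | omega | rfl

theorem ninePointMatrix_apply (N : ℕ) (γ : ℝ) (p q : Node N) :
    ninePointMatrix (N - 1) γ p q =
      lapWeight (xc q - xc p) * (if yc q - yc p = 0 then 1 else 0) +
        (if xc q - xc p = 0 then 1 else 0) * lapWeight (yc q - yc p) +
        γ * (lapWeight (xc q - xc p) * lapWeight (yc q - yc p)) := by
  have hx : xc q - xc p = (q.1 : ℤ) - p.1 := by simp only [xc]; ring
  have hy : yc q - yc p = (q.2 : ℤ) - p.2 := by simp only [yc]; ring
  have h1 : ∀ i j : Fin (N - 1), (1 : Matrix (Fin (N - 1)) (Fin (N - 1)) ℝ) i j =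
      if (j : ℤ) - i = 0 then 1 else 0 := fun i j => by
    simp only [Matrix.one_apply, Fin.ext_iff]
    split_ifs <;> first | omega | rfl
  simp only [ninePointMatrix, lap₂, Matrix.add_apply, Matrix.smul_apply, kroneckerMap_apply,
    lap_apply_eq_lapWeight, h1, hx, hy, smul_eq_mul]

theorem sum_Icc_neg_one_one (f : ℤ → ℝ) :
    ∑ a ∈ Finset.Icc (-1 : ℤ) 1, f a = f (-1) + f 0 + f 1 := by
  rw [show Finset.Icc (-1 : ℤ) 1 = {-1, 0, 1} by decide]
  rw [Finset.sum_insert (by decide), Finset.sum_insert (by decide), Finset.sum_singleton, add_assoc]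

/-- Consistency leaves a one-parameter family of stencils; ellipticity bounds the parameter. -/
theorem IsPoissonStencil.eq_ninePoint {K : ℤ → ℤ → ℝ} (hK : IsPoissonStencil K) :
    -(1 / 2) < K 1 1 ∧ ∀ a b : ℤ, K a b = lapWeight a * (if b = 0 then 1 else 0) +
      (if a = 0 then 1 else 0) * lapWeight b + K 1 1 * (lapWeight a * lapWeight b) := by
  have s1 : K (-1) (-1) = K 1 1 := hK.symm 1 1
  have s2 : K (-1) 1 = K 1 (-1) := by simpa using hK.symm 1 (-1)
  have s3 : K (-1) 0 = K 1 0 := by simpa using hK.symm 1 0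
  have s4 : K 0 (-1) = K 0 1 := by simpa using hK.symm 0 1
  have m0 := hK.moment_zero
  have mx := hK.moment_xx
  have my := hK.moment_yy
  have mm := hK.moment_xy
  simp only [sum_Icc_neg_one_one, s1, s2, s3, s4] at m0 mx my mm
  norm_num at m0 mx my mm
  have e1 : K 1 (-1) = K 1 1 := by linarith
  have e2 : K 1 0 = -1 - 2 * K 1 1 := by linarith
  have e3 : K 0 1 = -1 - 2 * K 1 1 := by linarith
  have e4 : K 0 0 = 4 + 4 * K 1 1 := by linarith
  refine ⟨?_, fun a b => ?_⟩
  · have hπ : Real.pi ∈ Set.Ioc (-Real.pi) Real.pi := ⟨by linarith [Real.pi_pos], le_rfl⟩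
    -- At `(π, π)` the symbol equals `8 + 16 K 1 1`.
    have he := hK.elliptic _ hπ _ hπ (Or.inl Real.pi_ne_zero)
    simp only [sum_Icc_neg_one_one, s1, s2, s3, s4, e1, e2, e3, e4] at he
    have c2 : Real.cos (Real.pi + Real.pi) = 1 := by rw [← two_mul, Real.cos_two_pi]
    have c3 : Real.cos (-Real.pi + -Real.pi) = 1 := by rw [← neg_add, Real.cos_neg, c2]
    norm_num [c2, c3] at he
    linarith
  · by_cases hab : 1 < |a| ∨ 1 < |b|
    · rw [hK.support a b hab]
      simp only [lt_abs] at hab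
      simp only [lapWeight]
      split_ifs <;> first | omega | simp
    · simp only [lt_abs] at hab
      have ha : a = -1 ∨ a = 0 ∨ a = 1 := by omega
      have hb : b = -1 ∨ b = 0 ∨ b = 1 := by omega
      rcases ha with rfl | rfl | rfl <;> rcases hb with rfl | rfl | rfl <;>
        simp only [s1, s2, s3, s4, e1, e2, e3, e4, lapWeight] <;> norm_num <;> ring

theorem fdmMatrix_eq {K : ℤ → ℤ → ℝ} (hK : IsPoissonStencil K) (N : ℕ) :
    fdmMatrix N K = ((N : ℝ) ^ 2) • ninePointMatrix (N - 1) (K 1 1) := by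
  ext p q
  rw [Matrix.smul_apply, ninePointMatrix_apply, fdmMatrix, of_apply,
    hK.eq_ninePoint.2 (xc q - xc p), smul_eq_mul]

/-! ### Stiffness matrices -/

open MeasureTheory Set

theorem ae_mul_notMem_range_intCast {c : ℝ} (hc : c ≠ 0) (d : ℝ) :
    ∀ᵐ s : ℝ, c * s - d ∉ range ((↑) : ℤ → ℝ) := by
  have h : ((fun s : ℝ => c * s - d) ⁻¹' range ((↑) : ℤ → ℝ)).Countable :=
    (countable_range _).preimage fun x y hxy => by
      have : c * x = c * y := by simpa using hxy
      exact mul_left_cancel₀ hc this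
  exact h.ae_notMem volume

theorem sub_intCast_notMem {x : ℝ} (k : ℤ) (hx : x ∉ range ((↑) : ℤ → ℝ)) :
    x - k ∉ range ((↑) : ℤ → ℝ) := by
  rintro ⟨m, hm⟩
  exact hx ⟨m + k, by push_cast; linarith⟩

/-- The two factors `N` from the gradients cancel against the change of variables in the plane, and
symmetry of the hat turns the second partial derivative into the first with swapped arguments.
Derivatives are needed only off the grid lines and diagonals, a null set. -/
theorem stiffnessMatrix_apply {hat g : ℝ → ℝ → ℝ} (hsymm : ∀ s t, hat s t = hat t s)
    (hderiv : ∀ s t, s ∉ range ((↑) : ℤ → ℝ) → t ∉ range ((↑) : ℤ → ℝ) →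
      s - t ∉ range ((↑) : ℤ → ℝ) → HasDerivAt (fun x => hat x t) (g s t) s)
    (hsupp : ∀ s t, g s t ≠ 0 → s ∈ Ioo (-1 : ℝ) 1 ∧ t ∈ Ioo (-1 : ℝ) 1)
    (hint : ∀ a b : ℤ, Integrable fun z : ℝ × ℝ => g (z.1 - a) (z.2 - b) * g z.1 z.2)
    {N : ℕ} (hN : N ≠ 0) (p q : Node N) :
    stiffnessMatrix N hat p q =
      (∫ z : ℝ × ℝ, g (z.1 - (xc q - xc p : ℤ)) (z.2 - (yc q - yc p : ℤ)) * g z.1 z.2) +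
      ∫ z : ℝ × ℝ, g (z.1 - (yc q - yc p : ℤ)) (z.2 - (xc q - xc p : ℤ)) * g z.1 z.2 := by
  have hN' : (N : ℝ) ≠ 0 := Nat.cast_ne_zero.2 hN
  set F : ℝ → ℝ → ℝ := fun s t =>
    g (s - xc q) (t - yc q) * g (s - xc p) (t - yc p) +
      g (t - yc q) (s - xc q) * g (t - yc p) (s - xc p) with hF
  have hd1 : ∀ r : Node N, ∀ s t : ℝ, N * s ∉ range ((↑) : ℤ → ℝ) → N * t ∉ range ((↑) : ℤ → ℝ) →
      N * s - N * t ∉ range ((↑) : ℤ → ℝ) →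
      deriv (fun x => basisFun N hat r x t) s = N * g (N * s - xc r) (N * t - yc r) := by
    intro r s t hs ht hst
    have h1 := hderiv (N * s - xc r) (N * t - yc r) (sub_intCast_notMem _ hs)
      (sub_intCast_notMem _ ht) (by
        have := sub_intCast_notMem (xc r - yc r) hst
        push_cast at this
        rwa [show (N : ℝ) * s - xc r - (N * t - yc r) = N * s - N * t - (xc r - yc r) by ring])
    have h2 : HasDerivAt (fun x : ℝ => N * x - xc r) N s := by
      simpa using ((hasDerivAt_id s).const_mul (N : ℝ)).sub_const (xc r : ℝ)
    have h3 := (HasDerivAt.comp s h1 h2).deriv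
    rw [mul_comm, ← h3]
    rfl
  have hd2 : ∀ r : Node N, ∀ s t : ℝ, N * s ∉ range ((↑) : ℤ → ℝ) → N * t ∉ range ((↑) : ℤ → ℝ) →
      N * s - N * t ∉ range ((↑) : ℤ → ℝ) →
      deriv (fun y => basisFun N hat r s y) t = N * g (N * t - yc r) (N * s - xc r) := by
    intro r s t hs ht hst
    have h1 := hderiv (N * t - yc r) (N * s - xc r) (sub_intCast_notMem _ ht)
      (sub_intCast_notMem _ hs) (by
        rintro ⟨m, hm⟩
        exact hst ⟨xc r - yc r - m, by push_cast; linarith⟩)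
    have h2 : HasDerivAt (fun x : ℝ => N * x - yc r) N t := by
      simpa using ((hasDerivAt_id t).const_mul (N : ℝ)).sub_const (yc r : ℝ)
    have h3 := (HasDerivAt.comp t h1 h2).deriv
    rw [mul_comm, ← h3]
    congr 1
    funext y
    exact hsymm _ _
  have hstep : stiffnessMatrix N hat p q =
      ∫ t in (0 : ℝ)..1, ∫ s in (0 : ℝ)..1, N * (N * F (N * s) (N * t)) := by
    rw [stiffnessMatrix, of_apply]
    refine intervalIntegral.integral_congr_ae ?_
    filter_upwards [ae_mul_notMem_range_intCast hN' 0] with t ht _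
    refine intervalIntegral.integral_congr_ae ?_
    filter_upwards [ae_mul_notMem_range_intCast hN' 0, ae_mul_notMem_range_intCast hN' (N * t)]
      with s hs hst _
    rw [sub_zero] at ht hs
    rw [hd1 q s t hs ht hst, hd1 p s t hs ht hst, hd2 q s t hs ht hst, hd2 p s t hs ht hst, hF]
    ring
  -- Interior nodes have coordinates between `1` and `N - 1`, so the support of a basis function
  -- stays in the scaled domain and the integrals extend to the whole line.
  have hFsupp : ∀ s t, F s t ≠ 0 → s ∈ Ioc (0 : ℝ) N ∧ t ∈ Ioc (0 : ℝ) N := by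
    intro s t h
    have h' : (s - xc p ∈ Ioo (-1 : ℝ) 1) ∧ (t - yc p ∈ Ioo (-1 : ℝ) 1) := by
      by_cases h1 : g (s - xc p) (t - yc p) = 0
      · by_cases h2 : g (t - yc p) (s - xc p) = 0
        · simp [hF, h1, h2] at h
        · exact (hsupp _ _ h2).symm
      · exact hsupp _ _ h1
    have hp1 := p.1.2
    have hp2 := p.2.2
    have hx : (xc p : ℝ) = ((p.1 : ℕ) : ℝ) + 1 := by simp [xc]
    have hy : (yc p : ℝ) = ((p.2 : ℕ) : ℝ) + 1 := by simp [yc]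
    have hx' : ((p.1 : ℕ) : ℝ) + 2 ≤ N := by exact_mod_cast (by omega : (p.1 : ℕ) + 2 ≤ N)
    have hy' : ((p.2 : ℕ) : ℝ) + 2 ≤ N := by exact_mod_cast (by omega : (p.2 : ℕ) + 2 ≤ N)
    have hx0 : (0 : ℝ) ≤ ((p.1 : ℕ) : ℝ) := Nat.cast_nonneg _
    have hy0 : (0 : ℝ) ≤ ((p.2 : ℕ) : ℝ) := Nat.cast_nonneg _
    obtain ⟨⟨h1, h2⟩, h3, h4⟩ := h'
    exact ⟨⟨by linarith, by linarith⟩, by linarith, by linarith⟩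
  have hinner : ∀ t, ∫ s in (0 : ℝ)..1, N * (N * F (N * s) t) = N * ∫ s, F s t := by
    intro t
    rw [intervalIntegral.integral_const_mul, intervalIntegral.integral_const_mul,
      intervalIntegral.mul_integral_comp_mul_left (f := fun s => F s t), mul_zero, mul_one,
      intervalIntegral.integral_eq_integral_of_support_subset]
    exact fun s hs => (hFsupp s t hs).1
  rw [hstep]
  simp only [hinner]
  rw [intervalIntegral.integral_const_mul,
    intervalIntegral.mul_integral_comp_mul_left (f := fun t => ∫ s, F s t), mul_zero, mul_one,
    intervalIntegral.integral_eq_integral_of_support_subset]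
  swap
  · intro t ht
    obtain ⟨s, hs⟩ : ∃ s, F s t ≠ 0 := by
      by_contra! hc
      exact ht (by simp [hc])
    exact (hFsupp s t hs).2
  set Φ : ℤ → ℤ → ℝ × ℝ → ℝ := fun a b z => g (z.1 - a) (z.2 - b) * g z.1 z.2 with hΦ
  have e1 : ∀ z : ℝ × ℝ, g (z.1 - xc q) (z.2 - yc q) * g (z.1 - xc p) (z.2 - yc p) =
      Φ (xc q - xc p) (yc q - yc p) (z - ((xc p : ℝ), (yc p : ℝ))) := by
    intro z
    simp only [hΦ, Prod.fst_sub, Prod.snd_sub]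
    push_cast
    rw [sub_sub_sub_cancel_right, sub_sub_sub_cancel_right]
  have e2 : ∀ z : ℝ × ℝ, g (z.2 - yc q) (z.1 - xc q) * g (z.2 - yc p) (z.1 - xc p) =
      Φ (yc q - yc p) (xc q - xc p) (z.swap - ((yc p : ℝ), (xc p : ℝ))) := by
    intro z
    simp only [hΦ, Prod.fst_sub, Prod.snd_sub, Prod.fst_swap, Prod.snd_swap]
    push_cast
    rw [sub_sub_sub_cancel_right, sub_sub_sub_cancel_right]
  have i1 : Integrable fun z => Φ (xc q - xc p) (yc q - yc p) (z - ((xc p : ℝ), (yc p : ℝ))) :=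
    (hint (xc q - xc p) (yc q - yc p)).comp_sub_right ((xc p : ℝ), (yc p : ℝ))
  have i2 : Integrable fun z => Φ (yc q - yc p) (xc q - xc p) (z - ((yc p : ℝ), (xc p : ℝ))) :=
    (hint (yc q - yc p) (xc q - xc p)).comp_sub_right ((yc p : ℝ), (xc p : ℝ))
  have i3 : Integrable fun z : ℝ × ℝ =>
      Φ (yc q - yc p) (xc q - xc p) (z.swap - ((yc p : ℝ), (xc p : ℝ))) := i2.swap
  have hsum : ∀ z : ℝ × ℝ, F z.1 z.2 =
      Φ (xc q - xc p) (yc q - yc p) (z - ((xc p : ℝ), (yc p : ℝ))) +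
        Φ (yc q - yc p) (xc q - xc p) (z.swap - ((yc p : ℝ), (xc p : ℝ))) := by
    intro z
    rw [← e1, ← e2]
  have hFi : Integrable (fun z : ℝ × ℝ => F z.1 z.2) (volume.prod volume) := by
    simp only [hsum]
    exact i1.add i3
  rw [← integral_prod_symm (fun z : ℝ × ℝ => F z.1 z.2) hFi]
  simp only [hsum]
  refine (integral_add i1 i3).trans ?_
  congr 1
  · exact integral_sub_right_eq_self (μ := (volume : Measure (ℝ × ℝ)))
      (Φ (xc q - xc p) (yc q - yc p)) _
  · refine (integral_prod_swap (μ := volume) (ν := volume) (fun z : ℝ × ℝ =>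
      Φ (yc q - yc p) (xc q - xc p) (z - ((yc p : ℝ), (xc p : ℝ))))).trans ?_
    exact integral_sub_right_eq_self (μ := (volume : Measure (ℝ × ℝ)))
      (Φ (yc q - yc p) (xc q - xc p)) _

end Schemes

/-! ### Explicit stiffness entries for Q1 and P1 elements. -/

section FiniteElements

open MeasureTheory Set Filter Topology

/-- The indicator function of the open unit interval. -/
def unitInd (s : ℝ) : ℝ := (Ioo (0 : ℝ) 1).indicator (fun _ => 1) s

theorem unitInd_of_mem {s : ℝ} (h0 : 0 < s) (h1 : s < 1) : unitInd s = 1 := by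
  rw [unitInd, indicator_of_mem (show s ∈ Ioo (0 : ℝ) 1 from ⟨h0, h1⟩)]

theorem unitInd_of_le {s : ℝ} (h : s ≤ 0) : unitInd s = 0 :=
  indicator_of_notMem (fun hs : s ∈ Ioo (0 : ℝ) 1 => (hs.1.trans_le h).false) _

theorem unitInd_of_ge {s : ℝ} (h : 1 ≤ s) : unitInd s = 0 :=
  indicator_of_notMem (fun hs : s ∈ Ioo (0 : ℝ) 1 => (hs.2.trans_le h).false) _

theorem mem_Ioo_of_unitInd_ne_zero {s : ℝ} (h : unitInd s ≠ 0) : 0 < s ∧ s < 1 := by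
  by_contra hs
  exact h (by rw [unitInd, indicator_of_notMem (show s ∉ Ioo (0 : ℝ) 1 from hs)])

/-- Integer translates of the open unit interval are equal or disjoint; this makes the slope
integrals combinatorial. -/
theorem unitInd_mul_unitInd (i j : ℤ) (s : ℝ) : unitInd (s + i) * unitInd (s + j) =
    if i = j then (Ioo (-i : ℝ) (1 - i)).indicator (fun _ => 1) s else 0 := by
  split_ifs with h
  · subst h
    by_cases hs : s ∈ Ioo (-i : ℝ) (1 - i)
    · rw [indicator_of_mem hs, unitInd_of_mem (by linarith [hs.1]) (by linarith [hs.2]), mul_one]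
    · rw [indicator_of_notMem hs]
      have : unitInd (s + i) = 0 := by
        by_contra h0
        have := mem_Ioo_of_unitInd_ne_zero h0
        exact hs ⟨by linarith [this.1], by linarith [this.2]⟩
      rw [this, zero_mul]
  · by_contra h0
    have h1 := mem_Ioo_of_unitInd_ne_zero (left_ne_zero_of_mul h0)
    have h2 := mem_Ioo_of_unitInd_ne_zero (right_ne_zero_of_mul h0)
    have h3 : (i : ℝ) < j + 1 := by linarith [h1.2, h2.1]
    have h4 : (j : ℝ) < i + 1 := by linarith [h2.2, h1.1]
    have h3' : i < j + 1 := by exact_mod_cast h3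
    have h4' : j < i + 1 := by exact_mod_cast h4
    omega

theorem integrable_unitInd_mul (i j : ℤ) :
    Integrable fun s : ℝ => unitInd (s + i) * unitInd (s + j) := by
  simp only [unitInd_mul_unitInd]
  split_ifs
  · exact (integrable_indicator_iff measurableSet_Ioo).2 (by simp)
  · exact integrable_zero _ _ _

theorem integral_unitInd_mul (i j : ℤ) :
    ∫ s : ℝ, unitInd (s + i) * unitInd (s + j) = if i = j then 1 else 0 := by
  simp only [unitInd_mul_unitInd]
  split_ifs
  · rw [integral_indicator measurableSet_Ioo]
    simp
  · simp

theorem eventually_between_of_notMem {s : ℝ} (hs : s ∉ range ((↑) : ℤ → ℝ)) :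
    ∃ i : ℤ, ∀ᶠ x in 𝓝 s, (i : ℝ) < x ∧ x < i + 1 := by
  refine ⟨⌊s⌋, (lt_mem_nhds ?_).and (gt_mem_nhds (Int.lt_floor_add_one s))⟩
  exact lt_of_le_of_ne (Int.floor_le s) fun h => hs ⟨_, h⟩

/-! ### Bilinear elements -/

/-- The one-dimensional hat function. -/
def hat₁ (s : ℝ) : ℝ := max 0 (1 - |s|)

theorem continuous_hat₁ : Continuous hat₁ := by
  unfold hat₁
  fun_prop

theorem hat₁_of_ge {s : ℝ} (h : 1 ≤ s) : hat₁ s = 0 := by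
  rw [hat₁, max_eq_left]
  linarith [le_abs_self s]

theorem hat₁_of_le {s : ℝ} (h : s ≤ -1) : hat₁ s = 0 := by
  rw [hat₁, max_eq_left]
  linarith [neg_le_abs s]

theorem hat₁_of_nonneg {s : ℝ} (h : 0 ≤ s) (h1 : s ≤ 1) : hat₁ s = 1 - s := by
  rw [hat₁, abs_of_nonneg h, max_eq_right (by linarith)]

theorem hat₁_of_nonpos {s : ℝ} (h : s ≤ 0) (h1 : -1 ≤ s) : hat₁ s = 1 + s := by
  rw [hat₁, abs_of_nonpos h, max_eq_right (by linarith), sub_neg_eq_add]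

theorem mem_Ioo_of_hat₁_ne_zero {s : ℝ} (h : hat₁ s ≠ 0) : s ∈ Ioo (-1 : ℝ) 1 := by
  by_contra hs
  rw [mem_Ioo, not_and_or, not_lt, not_lt] at hs
  exact h (hs.elim hat₁_of_le hat₁_of_ge)

theorem hasDerivAt_hat₁ {s : ℝ} (hs : s ∉ range ((↑) : ℤ → ℝ)) :
    HasDerivAt hat₁ (unitInd (s + 1) - unitInd s) s := by
  obtain ⟨i, hi⟩ := eventually_between_of_notMem hs
  have h0 := hi.self_of_nhds
  have hc : i = 0 ∨ i = -1 ∨ 1 ≤ i ∨ i ≤ -2 := by omega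
  rcases hc with rfl | rfl | h | h
  · push_cast at hi h0
    rw [unitInd_of_ge (by linarith), unitInd_of_mem h0.1 (by linarith)]
    have : HasDerivAt (fun x : ℝ => 1 - x) (0 - 1) s := by
      simpa using (hasDerivAt_id s).const_sub 1
    refine this.congr_of_eventuallyEq ?_
    filter_upwards [hi] with x hx
    exact hat₁_of_nonneg hx.1.le (by linarith)
  · push_cast at hi h0
    rw [unitInd_of_le (s := s) (by linarith), unitInd_of_mem (by linarith) (by linarith)]
    have : HasDerivAt (fun x : ℝ => 1 + x) (1 - 0) s := by
      simpa using (hasDerivAt_id s).const_add 1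
    refine this.congr_of_eventuallyEq ?_
    filter_upwards [hi] with x hx
    exact hat₁_of_nonpos (by linarith) (by linarith)
  · have h' : (1 : ℝ) ≤ i := by exact_mod_cast h
    rw [unitInd_of_ge (by linarith), unitInd_of_ge (by linarith), sub_zero]
    refine (hasDerivAt_const s 0).congr_of_eventuallyEq ?_
    filter_upwards [hi] with x hx
    exact hat₁_of_ge (by linarith)
  · have h' : (i : ℝ) ≤ -2 := by exact_mod_cast h
    rw [unitInd_of_le (by linarith), unitInd_of_le (by linarith), sub_zero]
    refine (hasDerivAt_const s 0).congr_of_eventuallyEq ?_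
    filter_upwards [hi] with x hx
    exact hat₁_of_le (by linarith)

/-- The entries of the one-dimensional mass matrix as a function of the offset. -/
def massWeight (d : ℤ) : ℝ := if d = 0 then 2 / 3 else if d = 1 ∨ d = -1 then 1 / 6 else 0

theorem integral_hat₁_mul (d : ℤ) : ∫ t : ℝ, hat₁ (t - d) * hat₁ t = massWeight d := by
  have hcont : Continuous fun t : ℝ => hat₁ (t - d) * hat₁ t :=
    (continuous_hat₁.comp (by fun_prop)).mul continuous_hat₁
  rw [← intervalIntegral.integral_eq_integral_of_support_subset (a := -1) (b := 1),
    ← intervalIntegral.integral_add_adjacent_intervals (b := 0) (hcont.intervalIntegrable _ _)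
      (hcont.intervalIntegrable _ _)]
  swap
  · intro t ht
    have := mem_Ioo_of_hat₁_ne_zero (right_ne_zero_of_mul ht)
    exact ⟨this.1, this.2.le⟩
  have hc : d = 0 ∨ d = 1 ∨ d = -1 ∨ 2 ≤ d ∨ d ≤ -2 := by omega
  have hle : ∀ {f : ℝ → ℝ} (e : ℝ → ℝ), (∀ t, -1 ≤ t → t ≤ 0 → f t = e t) →
      ∫ t in (-1 : ℝ)..0, f t = ∫ t in (-1 : ℝ)..0, e t := fun e h =>
    intervalIntegral.integral_congr fun t ht => by
      rw [uIcc_of_le (by norm_num)] at ht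
      exact h t ht.1 ht.2
  have hge : ∀ {f : ℝ → ℝ} (e : ℝ → ℝ), (∀ t, 0 ≤ t → t ≤ 1 → f t = e t) →
      ∫ t in (0 : ℝ)..1, f t = ∫ t in (0 : ℝ)..1, e t := fun e h =>
    intervalIntegral.integral_congr fun t ht => by
      rw [uIcc_of_le (by norm_num)] at ht
      exact h t ht.1 ht.2
  rcases hc with rfl | rfl | rfl | h | h
  · rw [hle (fun t => (t + 1) ^ 2), hge (fun t => (1 - t) ^ 2)]
    · rw [intervalIntegral.integral_comp_add_right (fun t : ℝ => t ^ 2),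
        intervalIntegral.integral_comp_sub_left (fun t : ℝ => t ^ 2)]
      norm_num [massWeight, integral_pow]
    · intro t h0 h1
      rw [Int.cast_zero, sub_zero, hat₁_of_nonneg h0 h1]
      ring
    · intro t h0 h1
      rw [Int.cast_zero, sub_zero, hat₁_of_nonpos h1 h0]
      ring
  · rw [hle (fun _ => 0), hge (fun t => t - t ^ 2)]
    · norm_num [massWeight, integral_pow]
    · intro t h0 h1
      rw [Int.cast_one, hat₁_of_nonpos (by linarith) (by linarith), hat₁_of_nonneg h0 h1]
      ring
    · intro t h0 h1
      rw [Int.cast_one, hat₁_of_le (by linarith), zero_mul]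
  · rw [hle (fun t => -(t + t ^ 2)), hge (fun _ => 0)]
    · rw [intervalIntegral.integral_neg, intervalIntegral.integral_add
        (Continuous.intervalIntegrable (by fun_prop) _ _)
        (Continuous.intervalIntegrable (by fun_prop) _ _)]
      norm_num [massWeight, integral_pow]
    · intro t h0 h1
      rw [hat₁_of_ge (by push_cast; linarith), zero_mul]
    · intro t h0 h1
      rw [hat₁_of_nonneg (by push_cast; linarith) (by push_cast; linarith), hat₁_of_nonpos h1 h0]
      push_cast
      ring
  · have h' : (2 : ℝ) ≤ d := by exact_mod_cast h
    rw [hle (fun _ => 0), hge (fun _ => 0)]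
    · rw [massWeight, if_neg (by omega), if_neg (by omega)]
      simp
    all_goals
      intro t h0 h1
      rw [hat₁_of_le (by linarith), zero_mul]
  · have h' : (d : ℝ) ≤ -2 := by exact_mod_cast h
    rw [hle (fun _ => 0), hge (fun _ => 0)]
    · rw [massWeight, if_neg (by omega), if_neg (by omega)]
      simp
    all_goals
      intro t h0 h1
      rw [hat₁_of_ge (by linarith), zero_mul]

theorem integrable_hat₁_mul (d : ℤ) : Integrable fun t : ℝ => hat₁ (t - d) * hat₁ t := by
  have hcont : Continuous fun t : ℝ => hat₁ (t - d) * hat₁ t :=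
    (continuous_hat₁.comp (by fun_prop)).mul continuous_hat₁
  refine hcont.integrable_of_hasCompactSupport ?_
  refine HasCompactSupport.intro (isCompact_Icc (a := (-1 : ℝ)) (b := 1)) fun t ht => ?_
  by_contra h0
  exact ht (Ioo_subset_Icc_self (mem_Ioo_of_hat₁_ne_zero (right_ne_zero_of_mul h0)))

theorem slope_mul_eq (d : ℤ) (s : ℝ) :
    (unitInd (s - d + 1) - unitInd (s - d)) * (unitInd (s + 1) - unitInd s) =
      unitInd (s + (1 - d : ℤ)) * unitInd (s + (1 : ℤ)) -
        unitInd (s + (1 - d : ℤ)) * unitInd (s + (0 : ℤ)) -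
        (unitInd (s + (-d : ℤ)) * unitInd (s + (1 : ℤ)) -
          unitInd (s + (-d : ℤ)) * unitInd (s + (0 : ℤ))) := by
  push_cast
  rw [show s + (1 - (d : ℝ)) = s - d + 1 by ring, show s + -(d : ℝ) = s - d by ring, add_zero]
  ring

theorem integrable_slope_mul (d : ℤ) : Integrable fun s : ℝ =>
    (unitInd (s - d + 1) - unitInd (s - d)) * (unitInd (s + 1) - unitInd s) := by
  simp only [slope_mul_eq]
  exact ((integrable_unitInd_mul _ _).sub (integrable_unitInd_mul _ _)).sub
    ((integrable_unitInd_mul _ _).sub (integrable_unitInd_mul _ _))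

theorem integral_slope_mul (d : ℤ) : ∫ s : ℝ,
    (unitInd (s - d + 1) - unitInd (s - d)) * (unitInd (s + 1) - unitInd s) = lapWeight d := by
  simp only [slope_mul_eq]
  rw [integral_sub, integral_sub, integral_sub]
  · simp only [integral_unitInd_mul, lapWeight]
    split_ifs <;> first | omega | norm_num
  all_goals first
    | exact integrable_unitInd_mul _ _
    | exact (integrable_unitInd_mul _ _).sub (integrable_unitInd_mul _ _)

/-- The matrix is `L ⊗ W + W ⊗ L` with mass matrix `W = 1 - L / 6`, which produces `γ = -1/3`. -/
theorem stiffnessMatrix_hatQ1 {N : ℕ} (hN : N ≠ 0) :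
    stiffnessMatrix N hatQ1 = ninePointMatrix (N - 1) (-(1 / 3)) := by
  set g : ℝ → ℝ → ℝ := fun s t => (unitInd (s + 1) - unitInd s) * hat₁ t with hg
  have hprod : ∀ a b : ℤ, (fun z : ℝ × ℝ => g (z.1 - a) (z.2 - b) * g z.1 z.2) = fun z =>
      ((unitInd (z.1 - a + 1) - unitInd (z.1 - a)) * (unitInd (z.1 + 1) - unitInd z.1)) *
        (hat₁ (z.2 - b) * hat₁ z.2) := by
    intro a b
    funext z
    simp only [hg]
    ring
  have hI : ∀ a b : ℤ, ∫ z : ℝ × ℝ, g (z.1 - a) (z.2 - b) * g z.1 z.2 =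
      lapWeight a * massWeight b := by
    intro a b
    rw [hprod]
    refine (integral_prod_mul (μ := volume) (ν := volume) (fun s : ℝ =>
      (unitInd (s - a + 1) - unitInd (s - a)) * (unitInd (s + 1) - unitInd s))
      (fun t : ℝ => hat₁ (t - b) * hat₁ t)).trans ?_
    rw [integral_slope_mul, integral_hat₁_mul]
  ext p q
  rw [stiffnessMatrix_apply (g := g) _ _ _ _ hN, hI, hI, ninePointMatrix_apply]
  · simp only [lapWeight, massWeight]
    split_ifs <;> first | omega | norm_num
  · intro s t
    exact mul_comm _ _
  · intro s t hs _ _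
    exact (hasDerivAt_hat₁ hs).mul_const (hat₁ t)
  · intro s t h
    refine ⟨?_, mem_Ioo_of_hat₁_ne_zero (right_ne_zero_of_mul h)⟩
    have h1 := left_ne_zero_of_mul h
    by_cases h0 : unitInd s = 0
    · rw [h0, sub_zero] at h1
      have := mem_Ioo_of_unitInd_ne_zero h1
      exact ⟨by linarith, by linarith⟩
    · have := mem_Ioo_of_unitInd_ne_zero h0
      exact ⟨by linarith, by linarith⟩
  · intro a b
    rw [hprod]
    exact (integrable_slope_mul a).mul_prod (integrable_hat₁_mul b)

/-! ### Linear elements -/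

/-- The slope of the P1 hat function in the first coordinate. -/
def slopeP1 (s t : ℝ) : ℝ :=
  unitInd (s + 1) * unitInd (t - s) - unitInd s * unitInd (t - s + 1)

theorem hatP1_comm (s t : ℝ) : hatP1 s t = hatP1 t s := by
  rw [hatP1, hatP1, max_comm |s|, abs_sub_comm]

theorem hatP1_eq_zero_of_one_le {s t : ℝ} (h : 1 ≤ |s| ∨ 1 ≤ |s - t|) : hatP1 s t = 0 := by
  rw [hatP1, max_eq_left]
  rcases h with h | h
  · have := (le_max_left |s| |t|).trans (le_max_left _ |s - t|)
    linarith
  · have := le_max_right (max |s| |t|) |s - t|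
    linarith

theorem hasDerivAt_hatP1 {s t : ℝ} (hs : s ∉ range ((↑) : ℤ → ℝ))
    (hst : s - t ∉ range ((↑) : ℤ → ℝ)) :
    HasDerivAt (fun x => hatP1 x t) (slopeP1 s t) s := by
  obtain ⟨i, hi⟩ := eventually_between_of_notMem hs
  obtain ⟨j, hj'⟩ := eventually_between_of_notMem hst
  have hj : ∀ᶠ x in 𝓝 s, (j : ℝ) < x - t ∧ x - t < j + 1 :=
    ((continuous_id.sub continuous_const).tendsto s).eventually hj'
  have h0 := hi.self_of_nhds
  have h1 := hj.self_of_nhds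
  have hzero : (1 ≤ i ∨ i ≤ -2 ∨ 1 ≤ j ∨ j ≤ -2) → HasDerivAt (fun x => hatP1 x t) 0 s := by
    intro h
    refine (hasDerivAt_const s 0).congr_of_eventuallyEq ?_
    filter_upwards [hi, hj] with x hx hx'
    apply hatP1_eq_zero_of_one_le
    rw [le_abs, le_abs]
    rcases h with h | h | h | h
    · have : (1 : ℝ) ≤ i := by exact_mod_cast h
      exact Or.inl (Or.inl (by linarith))
    · have : (i : ℝ) ≤ -2 := by exact_mod_cast h
      exact Or.inl (Or.inr (by linarith))
    · have : (1 : ℝ) ≤ j := by exact_mod_cast h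
      exact Or.inr (Or.inl (by linarith))
    · have : (j : ℝ) ≤ -2 := by exact_mod_cast h
      exact Or.inr (Or.inr (by linarith))
  -- The lines `s ∈ ℤ` and `s - t ∈ ℤ` cut the plane into parallelograms; the hat can be nonzero
  -- only on the four adjacent to the origin.
  have hc : (1 ≤ i ∨ i ≤ -2 ∨ 1 ≤ j ∨ j ≤ -2) ∨ ((i = 0 ∨ i = -1) ∧ (j = 0 ∨ j = -1)) := by omega
  rcases hc with h | ⟨rfl | rfl, rfl | rfl⟩
  · convert hzero h using 1
    rw [slopeP1]
    rcases h with h | h | h | h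
    · have : (1 : ℝ) ≤ i := by exact_mod_cast h
      rw [unitInd_of_ge (s := s + 1) (by linarith), unitInd_of_ge (s := s) (by linarith)]
      ring
    · have : (i : ℝ) ≤ -2 := by exact_mod_cast h
      rw [unitInd_of_le (s := s + 1) (by linarith), unitInd_of_le (s := s) (by linarith)]
      ring
    · have : (1 : ℝ) ≤ j := by exact_mod_cast h
      rw [unitInd_of_le (s := t - s + 1) (by linarith), unitInd_of_le (s := t - s) (by linarith)]
      ring
    · have : (j : ℝ) ≤ -2 := by exact_mod_cast h
      rw [unitInd_of_ge (s := t - s + 1) (by linarith), unitInd_of_ge (s := t - s) (by linarith)]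
      ring
  all_goals push_cast at hi hj h0 h1
  · have hv : slopeP1 s t = -1 := by
      rw [slopeP1, unitInd_of_ge (s := s + 1) (by linarith),
        unitInd_of_mem (s := s) (by linarith) (by linarith),
        unitInd_of_mem (s := t - s + 1) (by linarith) (by linarith)]
      ring
    rw [hv]
    -- The line `t = 0` cuts this parallelogram into two triangles with equal slope; `min t 0`
    -- covers both, including `t = 0`.
    have : HasDerivAt (fun x : ℝ => 1 + min t 0 - x) (-1) s := by
      simpa using (hasDerivAt_id s).const_sub (1 + min t 0)
    refine this.congr_of_eventuallyEq ?_
    filter_upwards [hi, hj] with x hx hx'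
    rw [hatP1, abs_of_pos hx.1, abs_of_pos hx'.1]
    rcases le_total t 0 with ht | ht
    · rw [abs_of_nonpos ht, min_eq_left ht, max_eq_right (max_le (by linarith) (by linarith)),
        max_eq_right (by linarith)]
      ring
    · rw [abs_of_nonneg ht, min_eq_right ht, max_eq_left (a := x) (by linarith),
        max_eq_left (a := x) (by linarith), max_eq_right (by linarith)]
      ring
  · have hv : slopeP1 s t = 0 := by
      rw [slopeP1, unitInd_of_ge (s := s + 1) (by linarith),
        unitInd_of_ge (s := t - s + 1) (by linarith)]
      ring
    rw [hv]
    refine (hasDerivAt_const s (max 0 (1 - t))).congr_of_eventuallyEq ?_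
    filter_upwards [hi, hj] with x hx hx'
    rw [hatP1, abs_of_pos hx.1, abs_of_neg (by linarith : x - t < 0),
      abs_of_pos (by linarith : 0 < t), max_eq_right (a := x) (by linarith),
      max_eq_left (a := t) (by linarith)]
  · have hv : slopeP1 s t = 0 := by
      rw [slopeP1, unitInd_of_le (s := t - s) (by linarith),
        unitInd_of_le (s := s) (by linarith)]
      ring
    rw [hv]
    refine (hasDerivAt_const s (max 0 (1 + t))).congr_of_eventuallyEq ?_
    filter_upwards [hi, hj] with x hx hx'
    rw [hatP1, abs_of_neg (by linarith : x < 0), abs_of_pos (by linarith : 0 < x - t),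
      abs_of_neg (by linarith : t < 0), max_eq_right (a := -x) (by linarith),
      max_eq_left (a := -t) (by linarith), sub_neg_eq_add]
  · have hv : slopeP1 s t = 1 := by
      rw [slopeP1, unitInd_of_le (s := s) (by linarith),
        unitInd_of_mem (s := s + 1) (by linarith) (by linarith),
        unitInd_of_mem (s := t - s) (by linarith) (by linarith)]
      ring
    rw [hv]
    have : HasDerivAt (fun x : ℝ => 1 - max t 0 + x) 1 s := by
      simpa using (hasDerivAt_id s).const_add (1 - max t 0)
    refine this.congr_of_eventuallyEq ?_
    filter_upwards [hi, hj] with x hx hx'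
    rw [hatP1, abs_of_neg (by linarith : x < 0), abs_of_neg (by linarith : x - t < 0)]
    rcases le_total t 0 with ht | ht
    · rw [abs_of_nonpos ht, max_eq_right ht, max_eq_left (a := -x) (by linarith),
        max_eq_left (a := -x) (by linarith), max_eq_right (by linarith)]
      ring
    · rw [abs_of_nonneg ht, max_eq_left ht, max_eq_right (max_le (by linarith) (by linarith)),
        max_eq_right (by linarith)]
      ring

theorem integrable_unitInd_mul_prod (i j k l : ℤ) : Integrable fun z : ℝ × ℝ =>
    (unitInd (z.1 + i) * unitInd (z.1 + j)) * (unitInd (z.2 + k) * unitInd (z.2 + l)) :=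
  (integrable_unitInd_mul i j).mul_prod (integrable_unitInd_mul k l)

theorem integral_unitInd_mul_prod (i j k l : ℤ) : ∫ z : ℝ × ℝ,
    (unitInd (z.1 + i) * unitInd (z.1 + j)) * (unitInd (z.2 + k) * unitInd (z.2 + l)) =
      (if i = j then 1 else 0) * (if k = l then 1 else 0) := by
  refine (integral_prod_mul (μ := volume) (ν := volume)
    (fun s : ℝ => unitInd (s + i) * unitInd (s + j))
    (fun t : ℝ => unitInd (t + k) * unitInd (t + l))).trans ?_
  rw [integral_unitInd_mul, integral_unitInd_mul]

/-- The product of two translated slopes in sheared coordinates. -/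
def shearedSlopeMul (a b : ℤ) (z : ℝ × ℝ) : ℝ :=
  (unitInd (z.1 + (1 - a : ℤ)) * unitInd (z.1 + (1 : ℤ))) *
      (unitInd (z.2 + (a - b : ℤ)) * unitInd (z.2 + (0 : ℤ))) -
    (unitInd (z.1 + (1 - a : ℤ)) * unitInd (z.1 + (0 : ℤ))) *
      (unitInd (z.2 + (a - b : ℤ)) * unitInd (z.2 + (1 : ℤ))) -
    ((unitInd (z.1 + (-a : ℤ)) * unitInd (z.1 + (1 : ℤ))) *
      (unitInd (z.2 + (a - b + 1 : ℤ)) * unitInd (z.2 + (0 : ℤ))) -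
    (unitInd (z.1 + (-a : ℤ)) * unitInd (z.1 + (0 : ℤ))) *
      (unitInd (z.2 + (a - b + 1 : ℤ)) * unitInd (z.2 + (1 : ℤ))))

theorem integrable_shearedSlopeMul (a b : ℤ) : Integrable (shearedSlopeMul a b) :=
  ((integrable_unitInd_mul_prod _ _ _ _).sub (integrable_unitInd_mul_prod _ _ _ _)).sub
    ((integrable_unitInd_mul_prod _ _ _ _).sub (integrable_unitInd_mul_prod _ _ _ _))

theorem integral_shearedSlopeMul (a b : ℤ) :
    ∫ z, shearedSlopeMul a b z = lapWeight a * (if b = 0 then 1 else 0) := by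
  have h1 := integrable_unitInd_mul_prod (1 - a) 1 (a - b) 0
  have h2 := integrable_unitInd_mul_prod (1 - a) 0 (a - b) 1
  have h3 := integrable_unitInd_mul_prod (-a) 1 (a - b + 1) 0
  have h4 := integrable_unitInd_mul_prod (-a) 0 (a - b + 1) 1
  have hsum : ∫ z, shearedSlopeMul a b z =
      (if a = 0 then 1 else 0) * (if b = a then 1 else 0) -
        (if a = 1 then 1 else 0) * (if b = a - 1 then 1 else 0) -
        ((if a = -1 then 1 else 0) * (if b = a + 1 then 1 else 0) -
          (if a = 0 then 1 else 0) * (if b = a then 1 else 0)) := by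
    refine (integral_sub (h1.sub h2) (h3.sub h4)).trans
      (congrArg₂ (· - ·) ((integral_sub h1 h2).trans ?_) ((integral_sub h3 h4).trans ?_))
    all_goals
      rw [integral_unitInd_mul_prod, integral_unitInd_mul_prod]
      congr 1 <;> congr 1 <;> exact if_congr (by omega) rfl rfl
  rw [hsum, lapWeight]
  rcases (by omega : a = 0 ∨ a = 1 ∨ a = -1 ∨ (a ≠ 0 ∧ a ≠ 1 ∧ a ≠ -1)) with
    rfl | rfl | rfl | ⟨k1, k2, k3⟩
  · norm_num
    split_ifs <;> norm_num
  · norm_num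
    split_ifs <;> norm_num
  · norm_num
    split_ifs <;> norm_num
  · simp [k1, k2, k3]

theorem slopeP1_mul_eq (a b : ℤ) (z : ℝ × ℝ) :
    slopeP1 (z.1 - a) (z.2 - b) * slopeP1 z.1 z.2 = shearedSlopeMul a b (z.1, z.2 - z.1) := by
  simp only [slopeP1, shearedSlopeMul]
  push_cast
  rw [show z.1 + (1 - (a : ℝ)) = z.1 - a + 1 by ring, show z.1 + -(a : ℝ) = z.1 - a by ring,
    show z.2 - b - (z.1 - a) = z.2 - z.1 + ((a : ℝ) - b) by ring,
    show z.2 - z.1 + ((a : ℝ) - b + 1) = z.2 - z.1 + ((a : ℝ) - b) + 1 by ring, add_zero, add_zero]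
  ring

/-- The slope is supported on two parallelograms, which the measure-preserving shear `(s, t) ↦ (s, t
- s)` turns into unit squares. The diagonal couplings vanish, so the five-point operator appears. -/
theorem stiffnessMatrix_hatP1 {N : ℕ} (hN : N ≠ 0) :
    stiffnessMatrix N hatP1 = ninePointMatrix (N - 1) 0 := by
  have hmp : MeasurePreserving (fun z : ℝ × ℝ => (z.1, z.2 - z.1)) :=
    measurePreserving_prod_sub (volume : Measure ℝ) (volume : Measure ℝ)
  have hint : ∀ a b : ℤ, Integrable fun z : ℝ × ℝ =>
      slopeP1 (z.1 - a) (z.2 - b) * slopeP1 z.1 z.2 := by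
    intro a b
    simp only [slopeP1_mul_eq]
    exact hmp.integrable_comp_of_integrable (integrable_shearedSlopeMul a b)
  have hI : ∀ a b : ℤ, ∫ z : ℝ × ℝ, slopeP1 (z.1 - a) (z.2 - b) * slopeP1 z.1 z.2 =
      lapWeight a * (if b = 0 then 1 else 0) := by
    intro a b
    simp only [slopeP1_mul_eq]
    rw [← integral_shearedSlopeMul]
    exact hmp.integral_comp (MeasurableEquiv.shearSubRight ℝ).measurableEmbedding
      (shearedSlopeMul a b)
  ext p q
  rw [stiffnessMatrix_apply (g := slopeP1) hatP1_comm _ _ hint hN, hI, hI, ninePointMatrix_apply]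
  · ring
  · exact fun s t hs _ hst => hasDerivAt_hatP1 hs hst
  · intro s t h
    by_cases h0 : unitInd (s + 1) * unitInd (t - s) = 0
    · rw [slopeP1, h0, zero_sub, neg_ne_zero] at h
      have h1 := mem_Ioo_of_unitInd_ne_zero (left_ne_zero_of_mul h)
      have h2 := mem_Ioo_of_unitInd_ne_zero (right_ne_zero_of_mul h)
      exact ⟨⟨by linarith, by linarith⟩, by linarith, by linarith⟩
    · have h1 := mem_Ioo_of_unitInd_ne_zero (left_ne_zero_of_mul h0)
      have h2 := mem_Ioo_of_unitInd_ne_zero (right_ne_zero_of_mul h0)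
      exact ⟨⟨by linarith, by linarith⟩, by linarith, by linarith⟩

end FiniteElements

/-- Every discretization is a multiple of a consistent elliptic nine-point operator. -/
theorem Scheme.exists_matrix_eq (d : Scheme) : ∃ γ : ℝ, -(1 / 2) < γ ∧ ∀ N : ℕ, N ≠ 0 →
    ∃ s : ℝ, 0 < s ∧ d.matrix N = s • ninePointMatrix (N - 1) γ := by
  cases d with
  | fdm K hK =>
    exact ⟨K 1 1, hK.eq_ninePoint.1, fun N hN => ⟨(N : ℝ) ^ 2, by positivity, fdmMatrix_eq hK N⟩⟩
  | femP1 =>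
    exact ⟨0, by norm_num, fun N hN => ⟨1, one_pos, by
      rw [one_smul]; exact stiffnessMatrix_hatP1 hN⟩⟩
  | femQ1 =>
    exact ⟨-(1 / 3), by norm_num, fun N hN => ⟨1, one_pos, by
      rw [one_smul]; exact stiffnessMatrix_hatQ1 hN⟩⟩

theorem Scheme.posDef (d : Scheme) (π : Prolongation) {M : ℕ} (hM : 1 ≤ M) :
    (d.matrix (2 * M)).PosDef ∧ (coarseMatrix (d.matrix (2 * M)) (π.matrix M)).PosDef := by
  obtain ⟨γ, hγ, h⟩ := d.exists_matrix_eq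
  obtain ⟨s, hs, h⟩ := h (2 * M) (by omega)
  rw [h]
  exact smul_posDef_and_coarse hγ hs π M

theorem card_node_lt {M : ℕ} (hM : 1 ≤ M) :
    Fintype.card (Node M) < Fintype.card (Node (2 * M)) := by
  simp only [Node, Fintype.card_prod, Fintype.card_fin]
  exact Nat.mul_self_lt_mul_self (by omega)

end MetaMgNet

end

theorem mainTheorem2 :
    -- the smoother property holds with one constant `cs` for all schemes, meshes and Meta-NNs
    (∃ cs : ℝ, 0 < cs ∧ ∀ (d : MetaMgNet.Scheme) (M : ℕ), 1 ≤ M → ∀ (L : ℕ)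
      (𝒢 : (MetaMgNet.Node (2 * M) → ℝ) → Matrix (MetaMgNet.Node (2 * M)) (Fin L) ℝ),
      MetaMgNet.Admissible 𝒢 → MetaMgNet.SmootherProperty (d.matrix (2 * M)) 𝒢 cs) ∧
    ∀ (d : MetaMgNet.Scheme) (π : MetaMgNet.Prolongation),
      -- stability and approximation, with `ca` independent of the mesh
      (∃ ca : ℝ, 0 < ca ∧ ∀ M : ℕ, 1 ≤ M →
        (d.matrix (2 * M)).PosDef ∧
        (MetaMgNet.coarseMatrix (d.matrix (2 * M)) (π.matrix M)).PosDef ∧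
        MetaMgNet.Stability (d.matrix (2 * M)) (π.matrix M) ∧
        MetaMgNet.Approximation (d.matrix (2 * M)) (π.matrix M) ca) ∧
      -- geometric convergence, for any constants for which the two inequalities hold
      ∀ (M : ℕ), 1 ≤ M → ∀ (L : ℕ)
        (𝒢 : (MetaMgNet.Node (2 * M) → ℝ) → Matrix (MetaMgNet.Node (2 * M)) (Fin L) ℝ),
        MetaMgNet.Admissible 𝒢 → ∀ ca cs : ℝ, 0 < ca → 0 < cs →
        MetaMgNet.Approximation (d.matrix (2 * M)) (π.matrix M) ca →
        MetaMgNet.SmootherProperty (d.matrix (2 * M)) 𝒢 cs →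
          0 ≤ 1 - 1 / (ca * cs) ∧ 1 - 1 / (ca * cs) < 1 ∧
          ∀ f u u₀ : MetaMgNet.Node (2 * M) → ℝ, d.matrix (2 * M) *ᵥ u = f → ∀ t : ℕ,
            MetaMgNet.energyNorm (d.matrix (2 * M))
                (u - MetaMgNet.iterates (d.matrix (2 * M)) (π.matrix M) 𝒢 f u₀ t) ≤
              (1 - 1 / (ca * cs)) ^ ((t : ℝ) / 2) *
                MetaMgNet.energyNorm (d.matrix (2 * M)) (u - u₀) := by
  refine ⟨⟨1, one_pos, fun d M hM L 𝒢 h𝒢 => ?_⟩, fun d π => ⟨?_, ?_⟩⟩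
  -- The prolongation is an arbitrary choice here; only positive definiteness of the fine matrix is
  -- used.
  · exact MetaMgNet.smootherProperty_one (d.posDef .sevenPoint hM).1 h𝒢
  · obtain ⟨γ, hγ, h⟩ := d.exists_matrix_eq
    obtain ⟨ca, hca, happ⟩ := MetaMgNet.approximation_ninePointMatrix hγ
    refine ⟨ca, hca, fun M hM => ?_⟩
    obtain ⟨hA, hAc⟩ := d.posDef π hM
    refine ⟨hA, hAc, MetaMgNet.stability_of_posDef hA hAc.isUnit, ?_⟩
    obtain ⟨s, hs, h⟩ := h (2 * M) (by omega)
    rw [h]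
    exact happ s hs π M hM
  · intro M hM L 𝒢 _ ca cs hca hcs happ hsm
    obtain ⟨hA, hAc⟩ := d.posDef π hM
    have h1 := MetaMgNet.one_le_mul_of_approximation hA (MetaMgNet.card_node_lt hM) hca happ hsm
    have hδ : 0 ≤ 1 - 1 / (ca * cs) := by
      rw [sub_nonneg, div_le_one (by positivity)]
      exact h1
    refine ⟨hδ, by linarith [show 0 < 1 / (ca * cs) by positivity], ?_⟩
    rintro f u u₀ rfl t
    exact MetaMgNet.energyNorm_sub_iterates_le hA hAc.isUnit hca hcs hδ happ hsm u u₀ t
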